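/- Let $p$ be a prime number and let $n\ge 0$ be an integer. Let $X$ be an irreducible, Noetherian scheme of characteristic $p$ which is smooth in the absolute sense (all its local rings are regular) and $F$-finite (its absolute Frobenius morphism is finite). For an ideal $J$ on $X$ (all ideals are coherent), $J^{[p^e]}$ denotes the ideal generated by the $p^e$-th powers of the local sections of $J$. For an ideal $\mathfrak b$ on $X$, $\mathfrak b^{[1/p^e]}$ denotes the smallest ideal $J$ with $\mathfrak b\subseteq J^{[p^e]}$. For an ideal $\mathfrak a$ on $X$ and a real number $\lambda\ge 0$, the test ideal $\tau(\mathfrak a^\lambda)$ is the ideal equal to $(\mathfrak a^{\lceil\lambda p^e\rceil})^{[1/p^e]}$ for all $e\gg 0$. If $\mathfrak a\ne\mathcal O_X$, its $F$-pure threshold is $$\operatorname{fpt}(\mathfrak a)=\inf\{\lambda\ge 0\mid \tau(\mathfrak a^\lambda)\neq\mathcal O_X\},$$ so that $\operatorname{fpt}(0)=0$. For a point $x$ of the zero locus of $\mathfrak a$, $\operatorname{fpt}_x(\mathfrak a)$ denotes the maximum of $\operatorname{fpt}(\mathfrak a|_V)$ over all open neighbourhoods $V$ of $x$. Consider the following sets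 of real numbers. * $\mathcal{F}pt(p)'_n$ is the set of all $\operatorname{fpt}_0(\mathfrak a)$, where $\mathfrak a\subset L[x_1,\dots,x_n]$ is an ideal vanishing at the origin and $L$ is an algebraically closed field of characteristic $p$. * $\mathcal{F}pt(p)_n$ is the set of all $\operatorname{fpt}(\mathfrak a)$, where $\mathfrak a$ is a proper ideal on an irreducible, $n$-dimensional, smooth scheme of finite type over a perfect field of characteristic $p$. * $\mathcal{F}pt(p)''_n$ is the set of all $\operatorname{fpt}(\mathfrak a)$, where $\mathfrak a$ is a proper ideal on an irreducible, Noetherian, $n$-dimensional, smooth (that is, regular), $F$-finite scheme of characteristic $p$. **Proposition.** The set $\mathcal{F}pt(p)'_n$ is a dense subset of $\mathcal{F}pt(p)''_n$ and also a dense subset of $\mathcal{F}pt(p)_n$. That is, $\mathcal{F}pt(p)'_n\subseteq \mathcal{F}pt(p)''_n$ and $\mathcal{F}pt(p)'_n\subseteq \mathcal{F}pt(p)_n$, and both $\mathcal{F}pt(p)''_n$ and $\mathcal{F}pt(p)_n$ are contained in the closure of $\mathcal{F}pt(p)'_n$ in $\mathbf R$. -/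

import Mathlib

open AlgebraicGeometry CategoryTheory

universe u

noncomputable section

namespace FThreshold

/-- The ideal of `R` generated by the `q`-th powers of the elements of `I`. -/
def powIdeal {R : Type*} [CommRing R] (I : Ideal R) (q : ℕ) : Ideal R :=
  Ideal.span ((fun u : R => u ^ q) '' (I : Set R))

/-- The ideal generated by `q`-th powers commutes with localization. -/
lemma map_powIdeal_of_isLocalization {R S : Type*} [CommRing R] [CommRing S] [Algebra R S]
    (M : Submonoid R) [IsLocalization M S] (I : Ideal R) (q : ℕ) :
    (powIdeal I q).map (algebraMap R S) = powIdeal (I.map (algebraMap R S)) q := by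
  apply le_antisymm
  · rw [powIdeal, Ideal.map_span, Ideal.span_le]
    rintro _ ⟨_, ⟨u, hu, rfl⟩, rfl⟩
    exact Ideal.subset_span ⟨algebraMap R S u, Ideal.mem_map_of_mem _ hu, (map_pow _ _ _).symm⟩
  · rw [powIdeal, Ideal.span_le]
    rintro _ ⟨v, hv, rfl⟩
    obtain ⟨⟨a, s⟩, h⟩ := (IsLocalization.mem_map_algebraMap_iff M S).mp hv
    have hs : IsUnit (algebraMap R S (s : R) ^ q) := (IsLocalization.map_units S s).pow q
    have h2 : v ^ q * algebraMap R S (s : R) ^ q = algebraMap R S ((a : R) ^ q) := by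
      rw [← mul_pow, h, map_pow]
    have h3 : v ^ q * algebraMap R S (s : R) ^ q ∈ (powIdeal I q).map (algebraMap R S) := by
      rw [h2]
      exact Ideal.mem_map_of_mem _ (Ideal.subset_span ⟨(a : R), a.2, rfl⟩)
    exact (Ideal.mul_unit_mem_iff_mem _ hs).mp h3

/-- For a coherent ideal sheaf `J` on `X`, the ideal sheaf whose sections on every affine open
are generated by the `q`-th powers of the sections of `J`. On a scheme of characteristic `p` and for
`q = p ^ e`, this is the Frobenius power `J^{[p^e]}`. -/
def frobeniusPower {X : Scheme.{u}} (J : X.IdealSheafData) (q : ℕ) : X.IdealSheafData where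
  ideal U := powIdeal (J.ideal U) q
  map_ideal_basicOpen U f := by
    have inst := U.2.isLocalization_basicOpen f
    rw [← J.map_ideal_basicOpen U f]
    exact map_powIdeal_of_isLocalization (S := Γ(X, X.basicOpen f))
      (Submonoid.powers f) (J.ideal U) q

/-- `b^{[1/p^e]}`, the smallest ideal sheaf `J` with `b ⊆ J^{[p^e]}`. -/
def frobeniusRoot (p : ℕ) {X : Scheme.{u}} (b : X.IdealSheafData) (e : ℕ) : X.IdealSheafData :=
  sInf {J | b ≤ frobeniusPower J (p ^ e)}

/-- The test ideal `τ(a^t)`, `t ≥ 0`: the ideal sheaf that is equal to `(a^{⌈t p^e⌉})^{[1/p^e]}` for all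
`e ≫ 0`. It is written as a lower limit in the lattice of ideal sheaves, which is the eventual value
of any sequence that is eventually constant (see `testIdeal_eq`). -/
def testIdeal (p : ℕ) {X : Scheme.{u}} (a : X.IdealSheafData) (t : ℝ) : X.IdealSheafData :=
  Filter.liminf (fun e : ℕ => frobeniusRoot p (a ^ ⌈t * (p : ℝ) ^ e⌉₊) e) Filter.atTop

lemma testIdeal_eq (p : ℕ) {X : Scheme.{u}} (a J : X.IdealSheafData) (t : ℝ)
    (h : ∀ᶠ e : ℕ in Filter.atTop, frobeniusRoot p (a ^ ⌈t * (p : ℝ) ^ e⌉₊) e = J) :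
    testIdeal p a t = J := by
  rw [testIdeal, Filter.liminf_congr h]
  exact Filter.liminf_const J

/-- The `F`-pure threshold of a proper ideal sheaf: the smallest `t ≥ 0` such that `τ(a^t) ≠ O_X`.
The convention `fpt 0 = 0` holds automatically (see `fpt_bot`). -/
def fpt (p : ℕ) {X : Scheme.{u}} (a : X.IdealSheafData) : ℝ :=
  sInf {t : ℝ | 0 ≤ t ∧ testIdeal p a t ≠ ⊤}

lemma fpt_bot (p : ℕ) (hp : p.Prime) {X : Scheme.{u}} [Nonempty X] :
    fpt p (⊥ : X.IdealSheafData) = 0 := by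
  have hne : (⊥ : X.IdealSheafData) ≠ ⊤ := by
    intro h
    have h1 : (⊥ : X.IdealSheafData).support = ⊥ := by rw [h]; rfl
    have h2 : (⊤ : TopologicalSpace.Closeds X) = ⊥ := by rw [← h1]; rfl
    obtain ⟨x⟩ := (inferInstance : Nonempty X)
    have h3 : x ∈ (⊥ : TopologicalSpace.Closeds X) := by
      rw [← h2]; trivial
    exact h3
  apply le_antisymm
  · refine le_of_forall_pos_le_add fun t ht => ?_
    rw [zero_add]
    refine csInf_le ⟨0, fun _ h => h.1⟩ ⟨ht.le, ?_⟩
    rw [testIdeal_eq p ⊥ ⊥ t]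
    · exact hne
    · refine Filter.Eventually.of_forall fun e => ?_
      have hpos : (0 : ℝ) < t * (p : ℝ) ^ e :=
        mul_pos ht (pow_pos (by exact_mod_cast hp.pos) e)
      have hc : ⌈t * (p : ℝ) ^ e⌉₊ ≠ 0 := (Nat.ceil_pos.mpr hpos).ne'
      have hz : (⊥ : X.IdealSheafData) ^ ⌈t * (p : ℝ) ^ e⌉₊ = ⊥ := zero_pow hc
      rw [hz, ← le_bot_iff]
      exact sInf_le (show (⊥ : X.IdealSheafData) ≤ frobeniusPower ⊥ (p ^ e) from bot_le)
  · exact Real.sInf_nonneg fun _ h => h.1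

/-- The local `F`-pure threshold at a point `x` of the zero locus of `a`: the maximum of `fpt (a|_V)`
over all open neighbourhoods `V` of `x`. -/
def fptAt (p : ℕ) {X : Scheme.{u}} (a : X.IdealSheafData) (x : X) : ℝ :=
  sSup {c : ℝ | ∃ V : X.Opens, x ∈ V ∧ fpt p (a.comap V.ι) = c}

/-- The ideal sheaf on `Spec R` defined by an ideal of `R`. -/
def idealSheaf {R : Type u} [CommRing R] (I : Ideal R) :
    (Spec (CommRingCat.of R)).IdealSheafData :=
  Scheme.IdealSheafData.ofIdealTop (I.map (Scheme.ΓSpecIso (CommRingCat.of R)).inv.hom)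

/-- The origin of affine space `Spec L[x_1, …, x_n]`: the inverse image of the zero ideal of `L`
under `f ↦ f(0)`. -/
def origin (n : ℕ) (L : Type u) [Field L] :
    Spec (CommRingCat.of (MvPolynomial (Fin n) L)) :=
  PrimeSpectrum.comap (MvPolynomial.constantCoeff : MvPolynomial (Fin n) L →+* L) ⊥

/-- A scheme of characteristic `p` (with `p = 0` in its structure sheaf) is `F`-finite if its absolute
Frobenius morphism is finite. That morphism is the identity on the underlying space and `f ↦ f ^ p`
on sections, so this says that `f ↦ f ^ p` is a finite ring homomorphism on every affine open. -/
def IsFFinite (p : ℕ) (X : Scheme.{u}) : Prop :=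
  ∀ U : X.affineOpens, ∃ φ : Γ(X, U) →+* Γ(X, U), (∀ f, φ f = f ^ p) ∧ φ.Finite

/-- The set of all `fpt_0(a)`, for `a ⊆ L[x_1, …, x_n]` an ideal that vanishes at the
origin and `L` an algebraically closed field of characteristic `p`. -/
def FptAffine (p n : ℕ) : Set ℝ :=
  {c | ∃ (L : Type u) (_ : Field L), IsAlgClosed L ∧ CharP L p ∧
    ∃ a : Ideal (MvPolynomial (Fin n) L),
      (∀ f ∈ a, MvPolynomial.eval (0 : Fin n → L) f = 0) ∧
      fptAt p (idealSheaf a) (origin n L) = c}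

/-- The set of all `fpt(a)`, for `a` a proper ideal on an irreducible, `n`-dimensional, smooth
scheme of finite type over a perfect field of characteristic `p`. -/
def Fpt (p n : ℕ) : Set ℝ :=
  {c | ∃ (L : Type u) (_ : Field L), PerfectField L ∧ CharP L p ∧
    ∃ (W : Scheme.{u}) (f : W ⟶ Spec (CommRingCat.of L)),
      Smooth f ∧ LocallyOfFiniteType f ∧ QuasiCompact f ∧
      IrreducibleSpace W ∧ topologicalKrullDim W = n ∧
      ∃ a : W.IdealSheafData, a ≠ ⊤ ∧ fpt p a = c}

/-- The set of all `fpt(a)`, for `a` a proper ideal on an irreducible, Noetherian, `n`-dimensional,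
`F`-finite scheme of characteristic `p` that is smooth in the absolute sense, that is, all of whose local
rings are regular. -/
def FptFFinite (p n : ℕ) : Set ℝ :=
  {c | ∃ X : Scheme.{u}, AlgebraicGeometry.IsNoetherian X ∧ IrreducibleSpace X ∧
      (∀ x : X, IsRegularLocalRing (X.presheaf.stalk x)) ∧
      (p : Γ(X, ⊤)) = 0 ∧ IsFFinite p X ∧ topologicalKrullDim X = n ∧
      ∃ a : X.IdealSheafData, a ≠ ⊤ ∧ fpt p a = c}

end FThreshold

end

/-!
On a quasi-compact scheme, `(a^r)^{[1/p^e]}` is a proper ideal sheaf if and only if there is a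
closed point `x` with `a_x ^ r ⊆ m_x^{[p^e]}`: if `a^r ⊆ J^{[p^e]}` with `J` proper, take `x` in the
zero locus of `J`, and conversely the ideal sheaf of `x` is a possible `J`. Hence `fpt` only depends
on these containments in the regular local rings of closed points (`testIdeal_ne_top_iff`).

*Inclusions.* Let `b` be an ideal of `L[x_1, …, x_n]` that vanishes at the origin, with maximal
ideal `M`, and let `c` be the infimum of all `t ≥ 0` with `b^{⌈t p^e⌉} ⊆ M^{[p^e]}` for arbitrarily
large `e`. The polynomial ring is free over its subring of `p^e`-th powers, so the ideals
`(b^r)^{[1/p^e]}` are generated by coordinates of elements of `b^r`. For `r = ⌈t p^e⌉` they contain,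
when `t < c` and `e` is large, polynomials outside `M` whose degree is bounded independently of `t`
and `e`. By finite dimensionality a single polynomial `g ∉ M` lies in all of them
(`exists_forall_mem_rootIdeal`). So `fpt_0(b) = c` is the threshold of `b` on the open set `g ≠ 0`
(`exists_fpt_comap_eq_fptAt`), which is a smooth scheme of dimension `n` over `L` and is `F`-finite.

*Density.* Let `c = fpt(a)` on a regular scheme of dimension at most `n`. For some large `e` there is a
closed point `x` with `a_x^{⌈t p^e⌉} ⊆ m_x^{[p^e]}` for a number `t` slightly above `c`, while this
fails for a number slightly below `c`. The ring `O_x / m_x^{[p^e]}` is a truncated polynomial ring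
`k[x_1, …, x_d] / (x_1^{p^e}, …, x_d^{p^e})`, with `d ≤ n`: it has a coefficient field, constructed
with Zorn's lemma by adjoining elements with given `p`-th powers, and the monomial property of
regular systems of parameters excludes further relations. Therefore there is an ideal `b` in a
polynomial ring over the algebraic closure of `k` with at most as many generators, for which the
same containments hold for this `e` (`exists_polynomial_model`). A containment at level `e`
determines `fpt_0(b)` up to `(number of generators + 1) / p^e`: containments persist by a pigeonhole
argument (`threshold_le_of_pow_le`), their failure by `F`-purity (`le_threshold_of_not_pow_le`). As
the number of generators of the stalks `a_x` is bounded, `fpt_0(b)` is close to `c`.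

Smooth schemes over a field fall under the same argument, as they are étale over affine space, hence
regular (`isRegularLocalRing_stalk_of_smooth`).
-/

noncomputable section

namespace FThreshold

/-! ### Frobenius powers of ideals -/

section FrobeniusPowers

variable {R : Type*} [CommRing R]

lemma powIdeal_mono {I J : Ideal R} (h : I ≤ J) (q : ℕ) : powIdeal I q ≤ powIdeal J q :=
  Ideal.span_mono (Set.image_mono h)

lemma pow_mem_powIdeal {I : Ideal R} {u : R} (hu : u ∈ I) (q : ℕ) : u ^ q ∈ powIdeal I q :=
  Ideal.subset_span ⟨u, hu, rfl⟩

lemma powIdeal_top (q : ℕ) : powIdeal (⊤ : Ideal R) q = ⊤ := by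
  rw [Ideal.eq_top_iff_one]
  simpa using pow_mem_powIdeal (Submodule.mem_top : (1 : R) ∈ (⊤ : Ideal R)) q

lemma powIdeal_le_self (I : Ideal R) {q : ℕ} (hq : q ≠ 0) : powIdeal I q ≤ I := by
  rw [powIdeal, Ideal.span_le]
  rintro _ ⟨u, hu, rfl⟩
  exact I.pow_mem_of_mem hu q (Nat.pos_of_ne_zero hq)

variable (p : ℕ) [ExpChar R p]

/-- In characteristic `p` the Frobenius power is the extension of the ideal along Frobenius, so that
it inherits the formal properties of `Ideal.map`. -/
lemma powIdeal_eq_map (I : Ideal R) (e : ℕ) :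
    powIdeal I (p ^ e) = I.map (iterateFrobenius R p e) := rfl

lemma powIdeal_span (s : Set R) (e : ℕ) :
    powIdeal (Ideal.span s) (p ^ e) = Ideal.span ((fun u => u ^ p ^ e) '' s) := by
  rw [powIdeal_eq_map, Ideal.map_span]
  rfl

lemma powIdeal_pow (I : Ideal R) (r e : ℕ) :
    powIdeal (I ^ r) (p ^ e) = powIdeal I (p ^ e) ^ r := by
  rw [powIdeal_eq_map, powIdeal_eq_map, Ideal.map_pow]

lemma powIdeal_powIdeal (I : Ideal R) (d e : ℕ) :
    powIdeal (powIdeal I (p ^ d)) (p ^ e) = powIdeal I (p ^ (d + e)) := by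
  rw [powIdeal_eq_map, powIdeal_eq_map, powIdeal_eq_map, Ideal.map_map, add_comm d e]
  congr 1
  ext x
  simp [iterateFrobenius_def, ← pow_mul, pow_add, mul_comm]

/-- A pigeonhole estimate: among `(r + μ) * p ^ e` factors taken from `μ` generators, at least `r`
disjoint groups consist of `p ^ e` copies of the same generator. -/
lemma pow_le_powIdeal_pow (s : Finset R) (r e : ℕ) :
    Ideal.span (s : Set R) ^ ((r + s.card) * p ^ e) ≤
      powIdeal (Ideal.span (s : Set R) ^ r) (p ^ e) := by
  classical
  rw [powIdeal_pow]
  induction s using Finset.induction_on generalizing r with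
  | empty =>
    rcases Nat.eq_zero_or_pos r with rfl | hr
    · simp
    · have : (r + (∅ : Finset R).card) * p ^ e ≠ 0 := by
        have := expChar_pos R p
        simp only [Finset.card_empty]
        positivity
      rw [Finset.coe_empty, Ideal.span_empty, ← Ideal.zero_eq_bot, zero_pow this]
      exact bot_le
  | insert f s hf ih =>
    have hq : 0 < p ^ e := pow_pos (expChar_pos R p) e
    set q := p ^ e with hqdef
    set N := (r + (insert f s).card) * q with hN
    have hsup : Ideal.span ((insert f s : Finset R) : Set R) =
        Ideal.span {f} + Ideal.span (s : Set R) := by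
      rw [Finset.coe_insert, Ideal.span_insert]; rfl
    have hK : Ideal.span {f ^ q} ≤ powIdeal (Ideal.span ((insert f s : Finset R) : Set R)) q := by
      rw [Ideal.span_singleton_le_iff_mem]
      exact pow_mem_powIdeal (Ideal.subset_span (by simp)) q
    have hK' : powIdeal (Ideal.span (s : Set R)) q ≤
        powIdeal (Ideal.span ((insert f s : Finset R) : Set R)) q :=
      powIdeal_mono (Ideal.span_mono (by simp)) q
    set K := powIdeal (Ideal.span ((insert f s : Finset R) : Set R)) q with hKdef
    rw [hsup, add_pow]
    refine Finset.sum_induction _ (fun I => I ≤ K ^ r) (fun I J hI hJ => sup_le hI hJ) bot_le ?_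
    intro i hi
    refine Ideal.mul_le_left.trans ?_
    have hi' : i ≤ N := Nat.lt_succ_iff.mp (Finset.mem_range.mp hi)
    -- `f ^ i` accounts for `i / q` groups, the other generators for the remaining ones
    have h1 : Ideal.span {f} ^ i ≤ K ^ (i / q) := by
      calc Ideal.span {f} ^ i ≤ Ideal.span {f} ^ (q * (i / q)) :=
            Ideal.pow_le_pow_right (Nat.mul_div_le i q)
        _ = Ideal.span {f ^ q} ^ (i / q) := by
            rw [pow_mul, Ideal.span_singleton_pow]
        _ ≤ K ^ (i / q) := Ideal.pow_right_mono hK _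
    rcases le_or_gt r (i / q) with hr | hr
    · exact Ideal.mul_le_left.trans (h1.trans (Ideal.pow_le_pow_right hr))
    · have h2 : (r - i / q + s.card) * q ≤ N - i := by
        have h3 : i < q * (i / q) + q := by
          have := Nat.div_add_mod i q
          have := Nat.mod_lt i hq
          omega
        obtain ⟨d, hd⟩ := Nat.exists_eq_add_of_lt hr
        have h4 : r - i / q = d + 1 := by omega
        rw [h4, hN, Finset.card_insert_of_notMem hf, hd]
        apply Nat.le_sub_of_add_le
        nlinarith
      calc Ideal.span {f} ^ i * Ideal.span (s : Set R) ^ (N - i)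
          ≤ K ^ (i / q) * K ^ (r - i / q) := Ideal.mul_mono h1
            ((Ideal.pow_le_pow_right h2).trans
              ((ih (r - i / q)).trans (Ideal.pow_right_mono hK' _)))
        _ = K ^ r := by rw [← pow_add]; congr 1; omega

/-- Containment in a Frobenius power persists, with a bounded loss, for all higher powers. -/
lemma pow_le_powIdeal_of_pow_le (s : Finset R) {J : Ideal R} {r e : ℕ}
    (h : Ideal.span (s : Set R) ^ r ≤ powIdeal J (p ^ e)) (d : ℕ) :
    Ideal.span (s : Set R) ^ ((r + s.card) * p ^ d) ≤ powIdeal J (p ^ (e + d)) := by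
  rw [← powIdeal_powIdeal]
  exact (pow_le_powIdeal_pow p s r d).trans (powIdeal_mono h _)

/-- Large powers of a finitely generated ideal lie in its Frobenius power. -/
lemma pow_le_powIdeal_self (s : Finset R) (e : ℕ) :
    Ideal.span (s : Set R) ^ ((1 + s.card) * p ^ e) ≤
      powIdeal (Ideal.span (s : Set R)) (p ^ e) := by
  simpa using pow_le_powIdeal_pow p s 1 e

end FrobeniusPowers

/-! ### Frobenius powers in local rings -/

section Localization

variable {R S : Type*} [CommRing R] [CommRing S] [Algebra R S]

/-- Containment of a power in the Frobenius power of the maximal ideal of `R_P`, read off in `R`. -/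
lemma map_pow_le_powIdeal_iff (P : Ideal R) [P.IsPrime] [IsLocalization.AtPrime S P]
    [IsLocalRing S] (I : Ideal R) (r q : ℕ) :
    I.map (algebraMap R S) ^ r ≤ powIdeal (IsLocalRing.maximalIdeal S) q ↔
      ∀ u ∈ I ^ r, ∃ s ∉ P, s * u ∈ powIdeal P q := by
  rw [← IsLocalization.AtPrime.map_eq_maximalIdeal P S,
    ← map_powIdeal_of_isLocalization P.primeCompl, ← Ideal.map_pow, Ideal.map_le_iff_le_comap]
  refine forall₂_congr fun u _ => ?_
  rw [Ideal.mem_comap, IsLocalization.algebraMap_mem_map_algebraMap_iff P.primeCompl]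
  rfl

end Localization

/-! ### Frobenius roots of ideals in polynomial rings -/

section FrobeniusRoots

open MvPolynomial

lemma injective_smul_add {σ : Type*} {q : ℕ} (hq : q ≠ 0) (a : σ →₀ ℕ) :
    Function.Injective (fun b : σ →₀ ℕ => q • b + a) := by
  intro b c h
  ext i
  have := DFunLike.congr_fun h i
  simpa [hq] using this

variable {σ L : Type*} [Field L] (p : ℕ) [ExpChar L p] [PerfectRing L p]

/-- The coordinate of a polynomial `f` at `X ^ a` with respect to the monomials `X ^ a`, all of
whose exponents are less than `q = p ^ e`: for such exponents `f = ∑ a, (frobeniusCoord p e a f) ^ q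
* X ^ a`, see `sum_frobeniusCoord`. -/
def frobeniusCoord (e : ℕ) (a : σ →₀ ℕ) (f : MvPolynomial σ L) : MvPolynomial σ L :=
  ∑ b ∈ f.support.preimage (fun b => p ^ e • b + a)
    (injective_smul_add (pow_ne_zero e (expChar_pos L p).ne') a).injOn,
    monomial b ((iterateFrobeniusEquiv L p e).symm (coeff (p ^ e • b + a) f))

lemma coeff_frobeniusCoord (e : ℕ) (a b : σ →₀ ℕ) (f : MvPolynomial σ L) :
    coeff b (frobeniusCoord p e a f) =
      (iterateFrobeniusEquiv L p e).symm (coeff (p ^ e • b + a) f) := by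
  classical
  simp only [frobeniusCoord, coeff_sum, coeff_monomial, Finset.sum_ite_eq']
  split_ifs with h
  · rfl
  · rw [Finset.mem_preimage, mem_support_iff, not_not] at h
    rw [h, map_zero]

lemma frobeniusCoord_add (e : ℕ) (a : σ →₀ ℕ) (f g : MvPolynomial σ L) :
    frobeniusCoord p e a (f + g) = frobeniusCoord p e a f + frobeniusCoord p e a g := by
  ext b
  simp only [coeff_frobeniusCoord, coeff_add, map_add]

lemma frobeniusCoord_zero (e : ℕ) (a : σ →₀ ℕ) :
    frobeniusCoord p e a (0 : MvPolynomial σ L) = 0 := by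
  ext b
  simp only [coeff_frobeniusCoord, coeff_zero, map_zero]

variable [Fintype σ]

/-- The exponent vectors with entries less than `p ^ e`. -/
def digits (e : ℕ) (a : σ → Fin (p ^ e)) : σ →₀ ℕ :=
  Finsupp.equivFunOnFinite.symm fun i => (a i : ℕ)

/-- The coordinates are linear over the subring of `p ^ e`-th powers. -/
lemma frobeniusCoord_pow_mul (e : ℕ) (a : σ → Fin (p ^ e)) (u f : MvPolynomial σ L) :
    frobeniusCoord p e (digits p e a) (u ^ p ^ e * f) =
      u * frobeniusCoord p e (digits p e a) f := by
  classical
  have hq : 0 < p ^ e := pow_pos (expChar_pos L p) e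
  induction u using MvPolynomial.induction_on' with
  | monomial c x =>
    ext b
    rw [monomial_pow, coeff_frobeniusCoord, coeff_monomial_mul', coeff_monomial_mul',
      coeff_frobeniusCoord]
    have hle : p ^ e • c ≤ p ^ e • b + digits p e a ↔ c ≤ b := by
      rw [Finsupp.le_def, Finsupp.le_def]
      refine forall_congr' fun i => ?_
      have hi : (digits p e a) i < p ^ e := (a i).2
      simp only [Finsupp.smul_apply, Finsupp.add_apply, smul_eq_mul]
      constructor
      · intro h
        by_contra! hlt
        nlinarith [Nat.mul_le_mul_left (p ^ e) (Nat.succ_le_of_lt hlt)]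
      · intro h
        nlinarith [Nat.mul_le_mul_left (p ^ e) h]
    by_cases h : c ≤ b
    · rw [if_pos (hle.mpr h), if_pos h, map_mul]
      congr 1
      · rw [← iterateFrobenius_def, ← coe_iterateFrobeniusEquiv]
        exact (iterateFrobeniusEquiv L p e).symm_apply_apply x
      · congr 2
        ext i
        have := Nat.mul_le_mul_left (p ^ e) (h i)
        simp only [Finsupp.coe_tsub, Finsupp.coe_add, Finsupp.coe_smul, Pi.sub_apply, Pi.add_apply,
          Pi.smul_apply, smul_eq_mul, Nat.mul_sub]
        omega
    · rw [if_neg (hle.not.mpr h), if_neg h, map_zero]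
  | add u v hu hv =>
    rw [add_pow_expChar_pow, add_mul, frobeniusCoord_add, hu, hv, add_mul]

lemma sum_frobeniusCoord [DecidableEq σ] (e : ℕ) (f : MvPolynomial σ L) :
    ∑ a : σ → Fin (p ^ e), frobeniusCoord p e (digits p e a) f ^ p ^ e *
      monomial (digits p e a) 1 = f := by
  classical
  have hq : 0 < p ^ e := pow_pos (expChar_pos L p) e
  induction f using MvPolynomial.induction_on' with
  | monomial m x =>
    let a₀ : σ → Fin (p ^ e) := fun i => ⟨m i % p ^ e, Nat.mod_lt _ hq⟩
    let b₀ : σ →₀ ℕ := Finsupp.equivFunOnFinite.symm fun i => m i / p ^ e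
    have hm : p ^ e • b₀ + digits p e a₀ = m := by
      ext i
      exact Nat.div_add_mod (m i) (p ^ e)
    rw [Finset.sum_eq_single a₀]
    · have : frobeniusCoord p e (digits p e a₀) (monomial m x) =
          monomial b₀ ((iterateFrobeniusEquiv L p e).symm x) := by
        ext b
        rw [coeff_frobeniusCoord, coeff_monomial, coeff_monomial]
        by_cases h : b₀ = b
        · rw [if_pos h, ← h, hm, if_pos rfl]
        · rw [if_neg h, if_neg, map_zero]
          intro h'
          rw [← hm] at h'
          exact h (injective_smul_add hq.ne' _ h')
      rw [this, monomial_pow, monomial_mul, hm, mul_one, ← iterateFrobenius_def,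
        ← coe_iterateFrobeniusEquiv]
      congr 1
      exact (iterateFrobeniusEquiv L p e).apply_symm_apply x
    · intro a _ ha
      have : frobeniusCoord p e (digits p e a) (monomial m x) = 0 := by
        ext b
        rw [coeff_frobeniusCoord, coeff_monomial, if_neg, map_zero, coeff_zero]
        intro h
        apply ha
        ext i
        have hi : m i = p ^ e * b i + a i := by rw [h]; rfl
        change (a i : ℕ) = m i % p ^ e
        rw [hi, Nat.mul_add_mod, Nat.mod_eq_of_lt (a i).2]
      rw [this, zero_pow hq.ne', zero_mul]
    · exact fun h => (h (Finset.mem_univ _)).elim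
  | add f g hf hg =>
    conv_rhs => rw [← hf, ← hg]
    rw [← Finset.sum_add_distrib]
    refine Finset.sum_congr rfl fun a _ => ?_
    rw [frobeniusCoord_add, add_pow_expChar_pow, add_mul]

lemma totalDegree_frobeniusCoord_le (e : ℕ) (a : σ →₀ ℕ) (f : MvPolynomial σ L) :
    p ^ e * (frobeniusCoord p e a f).totalDegree ≤ f.totalDegree := by
  have hq : 0 < p ^ e := pow_pos (expChar_pos L p) e
  rw [mul_comm, ← Nat.le_div_iff_mul_le hq]
  refine Finset.sup_le fun b hb => ?_
  rw [Nat.le_div_iff_mul_le hq, mul_comm]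
  have h1 : p ^ e • b + a ∈ f.support := by
    rw [mem_support_iff] at hb ⊢
    intro h
    rw [coeff_frobeniusCoord, h, map_zero] at hb
    exact hb rfl
  have h2 := le_totalDegree h1
  rw [Finsupp.sum_fintype _ _ (fun _ => rfl)] at h2 ⊢
  refine le_trans ?_ h2
  rw [Finset.mul_sum]
  exact Finset.sum_le_sum fun i _ => by simp

lemma frobeniusCoord_mem {J : Ideal (MvPolynomial σ L)} {e : ℕ} {u : MvPolynomial σ L}
    (hu : u ∈ powIdeal J (p ^ e)) (a : σ → Fin (p ^ e)) :
    frobeniusCoord p e (digits p e a) u ∈ J := by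
  rw [powIdeal, Ideal.span] at hu
  induction hu using Submodule.closure_induction with
  | zero => rw [frobeniusCoord_zero]; exact J.zero_mem
  | add u v _ _ hu hv => rw [frobeniusCoord_add]; exact J.add_mem hu hv
  | smul_mem f u hu =>
    obtain ⟨v, hv, rfl⟩ := hu
    rw [smul_eq_mul, mul_comm, frobeniusCoord_pow_mul]
    exact J.mul_mem_right _ hv

/-- The smallest ideal `J` with `b ≤ J^{[p^e]}`, see `le_powIdeal_iff_rootIdeal_le`: it is generated
by the coordinates of the elements of `b`. -/
def rootIdeal (e : ℕ) (b : Ideal (MvPolynomial σ L)) : Ideal (MvPolynomial σ L) :=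
  Ideal.span {h | ∃ f ∈ b, ∃ a : σ → Fin (p ^ e), frobeniusCoord p e (digits p e a) f = h}

lemma mem_powIdeal_of_frobeniusCoord_mem {J : Ideal (MvPolynomial σ L)} {e : ℕ}
    {f : MvPolynomial σ L} (h : ∀ a : σ → Fin (p ^ e), frobeniusCoord p e (digits p e a) f ∈ J) :
    f ∈ powIdeal J (p ^ e) := by
  classical
  rw [← sum_frobeniusCoord p e f]
  exact Ideal.sum_mem _ fun a _ => Ideal.mul_mem_right _ _ (pow_mem_powIdeal (h a) _)

lemma le_powIdeal_iff_rootIdeal_le {b J : Ideal (MvPolynomial σ L)} {e : ℕ} :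
    b ≤ powIdeal J (p ^ e) ↔ rootIdeal p e b ≤ J := by
  rw [rootIdeal, Ideal.span_le]
  constructor
  · rintro h _ ⟨f, hf, a, rfl⟩
    exact frobeniusCoord_mem p (h hf) a
  · intro h f hf
    exact mem_powIdeal_of_frobeniusCoord_mem p fun a => h ⟨f, hf, a, rfl⟩

/-- The formation of `rootIdeal` is compatible with localization at a prime ideal. -/
lemma rootIdeal_le_of_forall_exists_mul_mem {b P : Ideal (MvPolynomial σ L)} [hP : P.IsPrime]
    {e : ℕ} (h : ∀ u ∈ b, ∃ s ∉ P, s * u ∈ powIdeal P (p ^ e)) : rootIdeal p e b ≤ P := by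
  have hq : p ^ e ≠ 0 := pow_ne_zero e (expChar_pos L p).ne'
  rw [rootIdeal, Ideal.span_le]
  rintro _ ⟨f, hf, a, rfl⟩
  obtain ⟨s, hs, hsf⟩ := h f hf
  have h1 : s ^ p ^ e * f ∈ powIdeal P (p ^ e) := by
    obtain ⟨k, hk⟩ := Nat.exists_eq_succ_of_ne_zero hq
    rw [hk, pow_succ, mul_assoc, ← hk]
    exact Ideal.mul_mem_left _ _ hsf
  have h2 := frobeniusCoord_mem p h1 a
  rw [frobeniusCoord_pow_mul] at h2
  exact (hP.mem_or_mem h2).resolve_left hs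

/-- `F`-purity of the polynomial ring. -/
lemma mem_powIdeal_of_pow_mem {J : Ideal (MvPolynomial σ L)} {e d : ℕ} {u : MvPolynomial σ L}
    (h : u ^ p ^ d ∈ powIdeal J (p ^ (e + d))) : u ∈ powIdeal J (p ^ e) := by
  rw [← powIdeal_powIdeal] at h
  have hq : 0 < p ^ d := pow_pos (expChar_pos L p) d
  have h1 := frobeniusCoord_mem p h (fun _ => ⟨0, hq⟩)
  have h2 : frobeniusCoord p d (digits p d fun _ : σ => ⟨0, hq⟩) (1 : MvPolynomial σ L) = 1 := by
    classical
    have h0 : digits p d (fun _ : σ => ⟨0, hq⟩) = 0 := by ext i; rfl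
    ext b
    rw [coeff_frobeniusCoord, h0, add_zero, coeff_one, coeff_one]
    by_cases hb : b = 0
    · simp [hb]
    · have hb' : ¬ (0 : σ →₀ ℕ) = b := fun h => hb h.symm
      rw [if_neg hb', if_neg, map_zero]
      intro h
      exact hb ((smul_eq_zero.mp h.symm).resolve_left hq.ne')
  rw [← mul_one (u ^ p ^ d), frobeniusCoord_pow_mul, h2, mul_one] at h1
  exact h1

lemma not_pow_le_powIdeal_of_not_pow_le {b J : Ideal (MvPolynomial σ L)} {r e : ℕ}
    (h : ¬ b ^ r ≤ powIdeal J (p ^ e)) {d r' : ℕ} (hr : r' ≤ r * p ^ d) :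
    ¬ b ^ r' ≤ powIdeal J (p ^ (e + d)) := by
  contrapose! h
  intro u hu
  refine mem_powIdeal_of_pow_mem (d := d) p (h (Ideal.pow_le_pow_right hr ?_))
  rw [pow_mul]
  exact Ideal.pow_mem_pow hu _

/-- The ideals `(b ^ r)^{[1/p^e]}` grow along `(r, e) ↦ (r * p ^ d, e + d)`. -/
lemma rootIdeal_pow_le {b : Ideal (MvPolynomial σ L)} {r e d r' : ℕ} (hr : r' ≤ r * p ^ d) :
    rootIdeal p e (b ^ r) ≤ rootIdeal p (e + d) (b ^ r') := by
  rw [← le_powIdeal_iff_rootIdeal_le]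
  by_contra h
  exact not_pow_le_powIdeal_of_not_pow_le p h hr ((le_powIdeal_iff_rootIdeal_le p).mpr le_rfl)

end FrobeniusRoots

/-! ### Thresholds of ideals -/

section Thresholds

variable {R : Type*} [CommRing R] (p : ℕ) (b J : Ideal R)

/-- The exponents `t` for which `b ^ ⌈t * p ^ e⌉` lies in `J^{[p^e]}` for arbitrarily large `e`. -/
def thresholdSet : Set ℝ :=
  {t | 0 ≤ t ∧ ∀ N : ℕ, ∃ e ≥ N, b ^ ⌈t * (p : ℝ) ^ e⌉₊ ≤ powIdeal J (p ^ e)}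

/-- The `F`-threshold of `b` with respect to `J`. If `J` is a maximal ideal, it is the `F`-pure
threshold of `b` at the corresponding point. -/
def threshold : ℝ := sInf (thresholdSet p b J)

lemma bddBelow_thresholdSet : BddBelow (thresholdSet p b J) := ⟨0, fun _ h => h.1⟩

lemma threshold_nonneg : 0 ≤ threshold p b J := Real.sInf_nonneg fun _ h => h.1

variable {b J}

lemma mem_thresholdSet_of_pow_le [ExpChar R p] (s : Finset R) {r e : ℕ}
    (h : Ideal.span (s : Set R) ^ r ≤ powIdeal J (p ^ e)) :
    ((r + s.card : ℕ) : ℝ) / (p : ℝ) ^ e ∈ thresholdSet p (Ideal.span (s : Set R)) J := by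
  have hp : (p : ℝ) ≠ 0 := by exact_mod_cast (expChar_pos R p).ne'
  refine ⟨by positivity, fun N => ⟨e + N, Nat.le_add_left N e, ?_⟩⟩
  have h1 : ((r + s.card : ℕ) : ℝ) / (p : ℝ) ^ e * (p : ℝ) ^ (e + N) =
      (((r + s.card) * p ^ N : ℕ) : ℝ) := by
    rw [pow_add]
    push_cast
    field_simp
  rw [h1, Nat.ceil_natCast]
  exact pow_le_powIdeal_of_pow_le p s h N

/-- Containment gives an upper bound for the threshold, up to an error that depends only on the
number of generators and vanishes as `e` grows. -/
lemma threshold_le_of_pow_le [ExpChar R p] (s : Finset R) {r e : ℕ}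
    (h : Ideal.span (s : Set R) ^ r ≤ powIdeal J (p ^ e)) :
    threshold p (Ideal.span (s : Set R)) J ≤ ((r + s.card : ℕ) : ℝ) / (p : ℝ) ^ e :=
  csInf_le (bddBelow_thresholdSet p _ J) (mem_thresholdSet_of_pow_le p s h)

lemma thresholdSet_nonempty [ExpChar R p] (hJ : J.FG) (hb : b ≤ J) :
    (thresholdSet p b J).Nonempty := by
  obtain ⟨s, rfl⟩ := hJ
  refine ⟨(1 + s.card : ℕ), Nat.cast_nonneg _, fun N => ⟨N, le_rfl, ?_⟩⟩
  have h1 : ((1 + s.card : ℕ) : ℝ) * (p : ℝ) ^ N = (((1 + s.card) * p ^ N : ℕ) : ℝ) := by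
    push_cast
    ring
  rw [h1, Nat.ceil_natCast]
  exact (Ideal.pow_right_mono hb _).trans (pow_le_powIdeal_self p s N)

variable {p} in
lemma ceil_mul_pow_add_le (t : ℝ) (e d : ℕ) :
    ⌈t * (p : ℝ) ^ (e + d)⌉₊ ≤ ⌈t * (p : ℝ) ^ e⌉₊ * p ^ d := by
  rw [Nat.ceil_le, pow_add, ← mul_assoc]
  push_cast
  exact mul_le_mul_of_nonneg_right (Nat.le_ceil _) (by positivity)

end Thresholds

/-! ### Thresholds in polynomial rings -/

section PolynomialThresholds

open MvPolynomial

variable {σ L : Type*} [Fintype σ] [Field L] (p : ℕ) [ExpChar L p] [PerfectRing L p]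
  {b J : Ideal (MvPolynomial σ L)}

/-- Failure of containment gives a lower bound for the threshold, because by `F`-purity it persists
for all higher powers of `p`. -/
lemma le_threshold_of_not_pow_le (hne : (thresholdSet p b J).Nonempty) {r e : ℕ}
    (h : ¬ b ^ r ≤ powIdeal J (p ^ e)) : (r : ℝ) / (p : ℝ) ^ e ≤ threshold p b J := by
  have hp : 0 < (p : ℝ) := by exact_mod_cast expChar_pos L p
  refine le_csInf hne fun t ht => ?_
  by_contra! hlt
  obtain ⟨e', he', hle⟩ := ht.2 e
  obtain ⟨d, rfl⟩ := Nat.exists_eq_add_of_le he'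
  refine not_pow_le_powIdeal_of_not_pow_le p h ?_ hle
  refine (ceil_mul_pow_add_le t e d).trans (Nat.mul_le_mul_right _ ?_)
  rw [Nat.ceil_le]
  exact ((lt_div_iff₀ (by positivity)).mp hlt).le

omit [Fintype σ] in
lemma pow_le_span_totalDegree_le {δ : ℕ} (hb : b ≤ Ideal.span {f | f ∈ b ∧ f.totalDegree ≤ δ})
    (r : ℕ) : b ^ r ≤ Ideal.span {f | f ∈ b ^ r ∧ f.totalDegree ≤ r * δ} := by
  induction r with
  | zero =>
    rw [pow_zero, Ideal.one_eq_top, top_le_iff, Ideal.eq_top_iff_one]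
    exact Ideal.subset_span ⟨Submodule.mem_top, by simp⟩
  | succ r ih =>
    rw [pow_succ]
    refine (Ideal.mul_mono ih hb).trans ?_
    rw [Ideal.span_mul_span', Ideal.span_le]
    rintro _ ⟨f, hf, g, hg, rfl⟩
    refine Ideal.subset_span ⟨Ideal.mul_mem_mul hf.1 hg.1, ?_⟩
    refine (totalDegree_mul f g).trans ?_
    rw [add_mul, one_mul]
    exact add_le_add hf.2 hg.2

lemma exists_le_span_totalDegree_le (b : Ideal (MvPolynomial σ L)) :
    ∃ δ : ℕ, b ≤ Ideal.span {f | f ∈ b ∧ f.totalDegree ≤ δ} := by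
  obtain ⟨s, hs⟩ := (isNoetherianRing_iff_ideal_fg (MvPolynomial σ L)).mp inferInstance b
  refine ⟨s.sup totalDegree, ?_⟩
  conv_lhs => rw [← hs]
  refine Submodule.span_mono fun f hf => ⟨?_, Finset.le_sup (f := totalDegree) hf⟩
  rw [← hs]
  exact Submodule.subset_span hf

/-- The increasing union over `e` of the ideals `(b ^ ⌈t * p ^ e⌉)^{[1/p^e]}`. -/
def rootUnion (b : Ideal (MvPolynomial σ L)) (t : ℝ) : Ideal (MvPolynomial σ L) :=
  ⨆ e : ℕ, rootIdeal p e (b ^ ⌈t * (p : ℝ) ^ e⌉₊)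

lemma monotone_rootIdeal_ceil (b : Ideal (MvPolynomial σ L)) (t : ℝ) :
    Monotone fun e : ℕ => rootIdeal p e (b ^ ⌈t * (p : ℝ) ^ e⌉₊) := by
  intro e e' he
  obtain ⟨d, rfl⟩ := Nat.exists_eq_add_of_le he
  exact rootIdeal_pow_le p (ceil_mul_pow_add_le t e d)

lemma antitone_rootUnion (b : Ideal (MvPolynomial σ L)) : Antitone (rootUnion p b) := by
  intro t t' h
  refine iSup_mono fun e => ?_
  rw [← le_powIdeal_iff_rootIdeal_le]
  refine (Ideal.pow_le_pow_right ?_).trans ((le_powIdeal_iff_rootIdeal_le p).mpr le_rfl)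
  exact Nat.ceil_mono (mul_le_mul_of_nonneg_right h (by positivity))

lemma eventually_mem_rootIdeal {t : ℝ} {g : MvPolynomial σ L} (hg : g ∈ rootUnion p b t) :
    ∃ N : ℕ, ∀ e ≥ N, g ∈ rootIdeal p e (b ^ ⌈t * (p : ℝ) ^ e⌉₊) := by
  rw [rootUnion, Submodule.mem_iSup_of_directed _ (monotone_rootIdeal_ceil p b t).directed_le] at hg
  obtain ⟨N, hN⟩ := hg
  exact ⟨N, fun e he => monotone_rootIdeal_ceil p b t he hN⟩

/-- Below the threshold, `rootUnion` contains elements outside `J` whose degree is bounded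
independently of the exponent. -/
lemma exists_mem_rootUnion_totalDegree_le {δ : ℕ}
    (hb : b ≤ Ideal.span {f | f ∈ b ∧ f.totalDegree ≤ δ}) {t : ℝ} (ht0 : 0 ≤ t)
    (ht : t ∉ thresholdSet p b J) :
    ∃ g ∈ rootUnion p b t, g ∉ J ∧ g.totalDegree ≤ δ * ⌈t + 1⌉₊ := by
  have hp : 0 < p := expChar_pos L p
  have h1 : ∃ e : ℕ, ¬ b ^ ⌈t * (p : ℝ) ^ e⌉₊ ≤ powIdeal J (p ^ e) := by
    by_contra! h
    exact ht ⟨ht0, fun N => ⟨N, le_rfl, h N⟩⟩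
  obtain ⟨e, he⟩ := h1
  set r := ⌈t * (p : ℝ) ^ e⌉₊ with hr
  have h2 : ∃ f ∈ b ^ r, f.totalDegree ≤ r * δ ∧ f ∉ powIdeal J (p ^ e) := by
    by_contra! h
    refine he ((pow_le_span_totalDegree_le hb r).trans (Ideal.span_le.mpr ?_))
    exact fun f hf => h f hf.1 hf.2
  obtain ⟨f, hf, hfδ, hfJ⟩ := h2
  have h3 : ∃ a : σ → Fin (p ^ e), frobeniusCoord p e (digits p e a) f ∉ J := by
    by_contra! h
    exact hfJ (mem_powIdeal_of_frobeniusCoord_mem p h)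
  obtain ⟨a, ha⟩ := h3
  refine ⟨_, ?_, ha, ?_⟩
  · exact le_iSup (fun e : ℕ => rootIdeal p e (b ^ ⌈t * (p : ℝ) ^ e⌉₊)) e
      (Ideal.subset_span ⟨f, hf, a, rfl⟩)
  · have h4 := (totalDegree_frobeniusCoord_le p e (digits p e a) f).trans hfδ
    have h5 : r ≤ p ^ e * ⌈t + 1⌉₊ := by
      rw [hr, Nat.ceil_le]
      push_cast
      have h6 : (0 : ℝ) < (p : ℝ) ^ e := by positivity
      nlinarith [Nat.le_ceil (t + 1)]
    refine Nat.le_of_mul_le_mul_left ?_ (pow_pos hp e)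
    calc p ^ e * (frobeniusCoord p e (digits p e a) f).totalDegree ≤ r * δ := h4
      _ ≤ p ^ e * ⌈t + 1⌉₊ * δ := Nat.mul_le_mul_right _ h5
      _ = p ^ e * (δ * ⌈t + 1⌉₊) := by ring

/-- A single polynomial `g ∉ J` lies in `(b ^ ⌈t * p ^ e⌉)^{[1/p^e]}` for all `t` below the
threshold and all large `e`. The elements of bounded degree of `rootUnion p b t` form
finite-dimensional vector spaces that decrease with `t`, hence are constant for `t` close to the
threshold. -/
lemma exists_forall_mem_rootIdeal (hJ : J ≠ ⊤) :
    ∃ g ∉ J, ∀ t : ℝ, 0 ≤ t → t < threshold p b J →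
      ∃ N : ℕ, ∀ e ≥ N, g ∈ rootIdeal p e (b ^ ⌈t * (p : ℝ) ^ e⌉₊) := by
  obtain ⟨δ, hδ⟩ := exists_le_span_totalDegree_le b
  rcases (threshold_nonneg p b J).eq_or_lt with h0 | h0
  · exact ⟨1, (Ideal.ne_top_iff_one J).mp hJ, fun t ht0 ht => by linarith⟩
  set c := threshold p b J with hc
  let D := δ * ⌈c + 1⌉₊
  let Z : ℝ → Submodule L (MvPolynomial σ L) := fun t =>
    (rootUnion p b t).restrictScalars L ⊓ restrictTotalDegree σ L D
  have hZ : Antitone Z := fun t t' h =>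
    inf_le_inf_right _ fun x hx => antitone_rootUnion p b h hx
  have hfin : ∀ t, FiniteDimensional L (Z t) := fun t =>
    Submodule.finiteDimensional_of_le (inf_le_right : Z t ≤ restrictTotalDegree σ L D)
  -- choose an exponent below the threshold with `Z` of minimal dimension
  obtain ⟨t₀, ⟨ht₀, ht₀c⟩, hmin⟩ : ∃ t₀ ∈ Set.Ico 0 c, ∀ t ∈ Set.Ico 0 c,
      Module.finrank L (Z t₀) ≤ Module.finrank L (Z t) := by
    have hS : (Set.Ico 0 c).Nonempty := ⟨0, le_rfl, h0⟩
    obtain ⟨t₀, ht₀, h⟩ := (wellFounded_lt (α := ℕ)).onFun (f := fun t => Module.finrank L (Z t))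
      |>.has_min (Set.Ico 0 c) hS
    exact ⟨t₀, ht₀, fun t ht => not_lt.mp (h t ht)⟩
  have hnot : t₀ ∉ thresholdSet p b J := fun h =>
    absurd (csInf_le (bddBelow_thresholdSet p b J) h) (not_le.mpr ht₀c)
  obtain ⟨g, hg, hgJ, hgD⟩ := exists_mem_rootUnion_totalDegree_le p hδ ht₀ hnot
  have hgZ : g ∈ Z t₀ := by
    refine ⟨hg, (mem_restrictTotalDegree _ _ _).mpr (hgD.trans ?_)⟩
    exact Nat.mul_le_mul_left _ (Nat.ceil_mono (by linarith))
  refine ⟨g, hgJ, fun t ht0 htc => eventually_mem_rootIdeal p ?_⟩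
  rcases le_total t t₀ with h | h
  · exact antitone_rootUnion p b h hg
  · have : Z t = Z t₀ :=
      Submodule.eq_of_le_of_finrank_le (hZ h) (hmin t ⟨ht0, htc⟩)
    rw [← this] at hgZ
    exact hgZ.1

end PolynomialThresholds

/-! ### Regular local rings and the monomial property -/

section RegularLocalRings

open IsLocalRing

lemma spanFinrank_span_image_le {R M ι : Type*} [Semiring R] [AddCommMonoid M] [Module R M]
    (x : ι → M) (S : Finset ι) : (Submodule.span R (x '' S)).spanFinrank ≤ S.card := by
  refine (Submodule.spanFinrank_span_le_ncard_of_finite (S.finite_toSet.image x)).trans ?_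
  rw [← Set.ncard_coe_finset]
  exact Set.ncard_image_le S.finite_toSet

section Family

variable {R ι : Type*} [CommRing R] [IsLocalRing R] [IsNoetherianRing R] [Fintype ι]
  [DecidableEq ι] {x : ι → R}

/-- The quotient of a regular local ring by part of a regular system of parameters is regular. -/
lemma isRegularLocalRing_quotient_span_image (hx : Ideal.span (Set.range x) = maximalIdeal R)
    (hd : ((Fintype.card ι : ℕ) : WithBot ℕ∞) ≤ ringKrullDim R) (S : Finset ι) :
    IsRegularLocalRing (R ⧸ Ideal.span (x '' S)) ∧
      ringKrullDim (R ⧸ Ideal.span (x '' S)) ≤ (Sᶜ.card : ℕ) := by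
  set I := Ideal.span (x '' S) with hI
  have hIm : I ≤ maximalIdeal R := hx ▸ Ideal.span_mono (Set.image_subset_range _ _)
  have hIt : I ≠ ⊤ := fun h => Ideal.IsPrime.ne_top inferInstance (top_le_iff.mp (h ▸ hIm))
  have : Nontrivial (R ⧸ I) := Ideal.Quotient.nontrivial_iff.mpr hIt
  have hloc : IsLocalRing (R ⧸ I) :=
    IsLocalRing.of_surjective' (Ideal.Quotient.mk I) Ideal.Quotient.mk_surjective
  have hmap : (maximalIdeal R).map (Ideal.Quotient.mk I) = maximalIdeal (R ⧸ I) :=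
    IsLocalRing.map_maximalIdeal_of_surjective _ Ideal.Quotient.mk_surjective
  have hspan : maximalIdeal (R ⧸ I) =
      Ideal.span ((fun i => Ideal.Quotient.mk I (x i)) '' (Sᶜ : Finset ι)) := by
    rw [← hmap, ← hx, Ideal.map_span]
    refine le_antisymm (Ideal.span_le.mpr ?_) (Ideal.span_mono ?_)
    · rintro _ ⟨_, ⟨i, rfl⟩, rfl⟩
      by_cases hi : i ∈ S
      · have : Ideal.Quotient.mk I (x i) = 0 :=
          Ideal.Quotient.eq_zero_iff_mem.mpr (Ideal.subset_span ⟨i, hi, rfl⟩)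
        rw [this]
        exact zero_mem _
      · exact Ideal.subset_span ⟨i, by simpa using hi, rfl⟩
    · rintro _ ⟨i, -, rfl⟩
      exact ⟨x i, ⟨i, rfl⟩, rfl⟩
  have hrank : (maximalIdeal (R ⧸ I)).spanFinrank ≤ Sᶜ.card :=
    hspan ▸ spanFinrank_span_image_le _ _
  have h1 : ringKrullDim R ≤ ringKrullDim (R ⧸ I) + (I.spanFinrank : ℕ) := by
    apply ringKrullDim_le_ringKrullDim_quotient_add_spanFinrank
    rwa [IsLocalRing.ringJacobson_eq_maximalIdeal]
  have h2 : I.spanFinrank ≤ S.card := spanFinrank_span_image_le _ _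
  have hle := ringKrullDim_le_spanFinrank_maximalIdeal (R ⧸ I)
  refine ⟨?_, hle.trans (by exact_mod_cast hrank)⟩
  apply IsRegularLocalRing.of_spanFinrank_maximalIdeal_le
  obtain ⟨d, hd'⟩ : ∃ d : ℕ, ringKrullDim (R ⧸ I) = d := by
    have hb := ringKrullDim_ne_bot (R := R ⧸ I)
    have ht := ringKrullDim_ne_top (R := R ⧸ I)
    lift ringKrullDim (R ⧸ I) to ℕ∞ using hb with d
    lift d to ℕ using (by simpa using ht)
    exact ⟨d, rfl⟩
  rw [hd'] at h1 ⊢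
  have h3 := hd.trans h1
  norm_cast at h3 ⊢
  have h4 := Finset.card_compl S
  omega

lemma notMem_span_image_of_notMem (hx : Ideal.span (Set.range x) = maximalIdeal R)
    (hd : ((Fintype.card ι : ℕ) : WithBot ℕ∞) ≤ ringKrullDim R) {S : Finset ι} {j : ι}
    (hj : j ∉ S) : x j ∉ Ideal.span (x '' S) := by
  intro h
  have h1 : maximalIdeal R = Ideal.span (x '' (Finset.univ.erase j : Finset ι)) := by
    rw [← hx]
    refine le_antisymm (Ideal.span_le.mpr ?_) (Ideal.span_mono (Set.image_subset_range _ _))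
    rintro _ ⟨i, rfl⟩
    by_cases hi : i = j
    · subst hi
      refine Ideal.span_mono (Set.image_mono fun k hk => ?_) h
      have : k ≠ i := by rintro rfl; exact hj hk
      simpa using this
    · exact Ideal.subset_span ⟨i, by simpa using hi, rfl⟩
  have h2 : (maximalIdeal R).spanFinrank ≤ (Finset.univ.erase j).card :=
    h1 ▸ spanFinrank_span_image_le _ _
  have h3 := hd.trans (ringKrullDim_le_spanFinrank_maximalIdeal R)
  rw [Finset.card_erase_of_mem (Finset.mem_univ j), Finset.card_univ] at h2
  have h4 : 0 < Fintype.card ι := Fintype.card_pos_iff.mpr ⟨j⟩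
  norm_cast at h3
  omega

end Family

/-- An element of the maximal ideal outside its square can be completed to a minimal system of
generators. -/
lemma exists_span_range_cons_eq {R : Type*} [CommRing R] [IsLocalRing R] {d : ℕ}
    {x : Fin (d + 1) → R}
    (hx : Ideal.span (Set.range x) = maximalIdeal R) {y : R} (hy : y ∈ maximalIdeal R)
    (hy2 : y ∉ maximalIdeal R ^ 2) :
    ∃ z : Fin d → R, Ideal.span (Set.range (Fin.cons y z : Fin (d + 1) → R)) = maximalIdeal R := by
  rw [← hx] at hy
  obtain ⟨c, hc⟩ := (Submodule.mem_span_range_iff_exists_fun R).mp hy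
  obtain ⟨i, hi⟩ : ∃ i, IsUnit (c i) := by
    by_contra! h
    apply hy2
    rw [← hc, pow_two]
    refine sum_mem fun i _ => Ideal.mul_mem_mul ((mem_maximalIdeal _).mpr (h i)) ?_
    exact hx ▸ Ideal.subset_span ⟨i, rfl⟩
  have hxm : ∀ j, x j ∈ maximalIdeal R := fun j => hx ▸ Ideal.subset_span ⟨j, rfl⟩
  refine ⟨fun j => x (i.succAbove j), le_antisymm (Ideal.span_le.mpr ?_) ?_⟩
  · rintro _ ⟨j, rfl⟩
    refine Fin.cases ?_ (fun j => ?_) j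
    · rw [Fin.cons_zero, ← hx]; exact hy
    · rw [Fin.cons_succ]; exact hxm _
  · set J := Ideal.span (Set.range (Fin.cons y (fun j => x (i.succAbove j)) : Fin (d + 1) → R))
    have h1 : ∀ j, x (i.succAbove j) ∈ J := fun j => Ideal.subset_span ⟨j.succ, by simp⟩
    have h2 : y ∈ J := Ideal.subset_span ⟨0, by simp⟩
    rw [← hx, Ideal.span_le]
    rintro _ ⟨j, rfl⟩
    rcases eq_or_ne j i with rfl | hj
    · rw [Fin.sum_univ_succAbove _ j] at hc
      have h3 : c j * x j ∈ J := by
        have : c j * x j = y - ∑ k, c (j.succAbove k) • x (j.succAbove k) := by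
          rw [← hc, smul_eq_mul]; ring
        rw [this]
        exact sub_mem h2 (sum_mem fun k _ => J.mul_mem_left _ (h1 k))
      exact (Ideal.unit_mul_mem_iff_mem J hi).mp h3
    · obtain ⟨k, rfl⟩ := Fin.exists_succAbove_eq hj
      exact h1 k

lemma exists_span_range_eq_maximalIdeal (R : Type*) [CommRing R] [IsRegularLocalRing R] :
    ∃ (d : ℕ) (x : Fin d → R), Ideal.span (Set.range x) = maximalIdeal R ∧ ringKrullDim R = d := by
  obtain ⟨s, hs, hspan⟩ :=
    Submodule.FG.exists_span_finset_card_eq_spanFinrank (maximalIdeal R).fg_of_isNoetherianRing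
  refine ⟨s.card, fun i => (s.equivFin.symm i : R), ?_, ?_⟩
  · rw [← hspan]
    congr 1
    ext y
    constructor
    · rintro ⟨i, rfl⟩; exact (s.equivFin.symm i).2
    · intro hy; exact ⟨s.equivFin ⟨y, hy⟩, by simp⟩
  · rw [hs, IsRegularLocalRing.spanFinrank_maximalIdeal]

lemma isDomain_of_ringKrullDim_eq (d : ℕ) : ∀ (R : Type u) [CommRing R] [IsRegularLocalRing R],
    ringKrullDim R = d → IsDomain R := by
  induction d with
  | zero =>
    intro R _ _ h
    have h1 : (maximalIdeal R).spanFinrank = 0 := by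
      have := IsRegularLocalRing.spanFinrank_maximalIdeal (R := R)
      rw [h] at this
      exact_mod_cast this
    have h2 := (Submodule.spanFinrank_eq_zero_iff_eq_bot
      (maximalIdeal R).fg_of_isNoetherianRing).mp h1
    exact (IsLocalRing.isField_iff_maximalIdeal_eq.mpr h2).isDomain
  | succ d ih =>
    intro R _ _ h
    obtain ⟨d', x, hx, hd'⟩ := exists_span_range_eq_maximalIdeal R
    obtain rfl : d' = d + 1 := by
      rw [h] at hd'
      exact_mod_cast hd'.symm
    -- prime avoidance: a parameter outside the square of the maximal ideal and all minimal primes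
    obtain ⟨y, hy, hy2, hyP⟩ : ∃ y ∈ maximalIdeal R, y ∉ maximalIdeal R ^ 2 ∧
        ∀ P ∈ minimalPrimes R, y ∉ P := by
      by_contra! hcon
      have hfin := minimalPrimes.finite_of_isNoetherianRing R
      have hsub : ((maximalIdeal R : Ideal R) : Set R) ⊆ (maximalIdeal R ^ 2 : Ideal R) ∪
          (maximalIdeal R ^ 2 : Ideal R) ∪ ⋃ P ∈ (hfin.toFinset : Set (Ideal R)), (P : Set R) := by
        intro y hy
        by_cases hy2 : y ∈ maximalIdeal R ^ 2
        · exact Or.inl (Or.inl hy2)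
        · obtain ⟨P, hP, hyP⟩ := hcon y hy hy2
          exact Or.inr (Set.mem_biUnion (by simpa using hP) hyP)
      have hne : ¬ maximalIdeal R ≤ maximalIdeal R ^ 2 := by
        intro hle
        have h1 : maximalIdeal R = ⊥ := by
          refine Submodule.eq_bot_of_le_smul_of_le_jacobson_bot (maximalIdeal R) _
            (maximalIdeal R).fg_of_isNoetherianRing ?_ (maximalIdeal_le_jacobson _)
          rwa [smul_eq_mul, ← pow_two]
        have h2 := ringKrullDim_eq_zero_of_isField (IsLocalRing.isField_iff_maximalIdeal_eq.mpr h1)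
        rw [h] at h2
        exact absurd h2 (by norm_cast)
      rcases (Ideal.subset_union_prime' (f := id) (a := maximalIdeal R ^ 2)
        (b := maximalIdeal R ^ 2) (fun P hP => ((hfin.mem_toFinset.mp hP).1.1))).mp hsub with
        h1 | h1 | ⟨P, hP, h1⟩
      · exact hne h1
      · exact hne h1
      · have hP' := hfin.mem_toFinset.mp hP
        have : P.IsPrime := hP'.1.1
        have hPm : P = maximalIdeal R := le_antisymm (le_maximalIdeal this.ne_top) h1
        have h2 : (maximalIdeal R).height = 0 := by
          rw [← hPm]
          exact Ideal.height_eq_zero_iff.mpr hP'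
        have h3 := maximalIdeal_height_eq_ringKrullDim (R := R)
        rw [h2, h] at h3
        exact absurd h3 (by norm_cast)
    obtain ⟨z, hz⟩ := exists_span_range_cons_eq hx hy hy2
    obtain ⟨hreg, hdim⟩ := isRegularLocalRing_quotient_span_image hz (by rw [h]; simp) {0}
    have himg : (Fin.cons y z : Fin (d + 1) → R) ''
        (({0} : Finset (Fin (d + 1))) : Set _) = {y} := by
      simp
    rw [himg] at hreg hdim
    have hdim' : ringKrullDim (R ⧸ Ideal.span {y}) = d := by
      refine le_antisymm (hdim.trans (by simp [Finset.card_compl])) ?_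
      have h1 : ringKrullDim R ≤ ringKrullDim (R ⧸ Ideal.span {y}) +
          ((Ideal.span {y}).spanFinrank : ℕ) := by
        apply ringKrullDim_le_ringKrullDim_quotient_add_spanFinrank
        rw [IsLocalRing.ringJacobson_eq_maximalIdeal]
        exact (Ideal.span_singleton_le_iff_mem _).mpr hy
      have h2 : (Ideal.span {y}).spanFinrank ≤ 1 := by
        refine (Submodule.spanFinrank_span_le_ncard_of_finite (Set.finite_singleton y)).trans ?_
        simp
      obtain ⟨d', -, -, hd'⟩ := exists_span_range_eq_maximalIdeal (R ⧸ Ideal.span {y})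
      rw [hd', h] at h1
      rw [hd']
      norm_cast at h1 ⊢
      omega
    have hdom := ih (R ⧸ Ideal.span {y}) hdim'
    have hprime : (Ideal.span {y}).IsPrime := (Ideal.Quotient.isDomain_iff_prime _).mp hdom
    obtain ⟨P, hP, hPy⟩ := Ideal.exists_minimalPrimes_le (bot_le : (⊥ : Ideal R) ≤ Ideal.span {y})
    have hPp : P.IsPrime := hP.1.1
    have hP0 : P = ⊥ := by
      refine Submodule.eq_bot_of_le_smul_of_le_jacobson_bot (maximalIdeal R) P
        P.fg_of_isNoetherianRing ?_ (maximalIdeal_le_jacobson _)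
      intro w hw
      obtain ⟨v, rfl⟩ := Ideal.mem_span_singleton'.mp (hPy hw)
      rw [mul_comm]
      exact Submodule.smul_mem_smul hy ((hPp.mem_or_mem hw).resolve_right (hyP P hP))
    rw [hP0] at hPp
    exact IsDomain.of_bot_isPrime R

/-- Regular local rings are domains. -/
lemma isDomain_of_isRegularLocalRing (R : Type u) [CommRing R] [IsRegularLocalRing R] :
    IsDomain R := by
  obtain ⟨d, -, -, hd⟩ := exists_span_range_eq_maximalIdeal R
  exact isDomain_of_ringKrullDim_eq d R hd

section Monomials

variable {R : Type u} {ι : Type*} [CommRing R] [DecidableEq ι]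

lemma span_pow_image_eq_sup (x : ι → R) (a : ι → ℕ) {S : Finset ι} {k : ι} (hk : k ∈ S) (c : ℕ) :
    Ideal.span ((fun i => x i ^ Function.update a k c i) '' (S : Set ι)) =
      Ideal.span {x k ^ c} ⊔ Ideal.span ((fun i => x i ^ a i) '' (S.erase k : Finset ι)) := by
  conv_lhs => rw [← Finset.insert_erase hk]
  rw [Finset.coe_insert, Set.image_insert_eq, Ideal.span_insert, Function.update_self]
  congr 2
  refine Set.image_congr fun i hi => ?_
  rw [Function.update_of_ne (Finset.ne_of_mem_erase hi)]

variable [IsLocalRing R] [IsNoetherianRing R] [Fintype ι] {x : ι → R}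

/-- The powers of a regular system of parameters form a regular sequence in any order. -/
lemma mem_span_pow_of_mul_mem (hx : Ideal.span (Set.range x) = maximalIdeal R)
    (hd : ((Fintype.card ι : ℕ) : WithBot ℕ∞) ≤ ringKrullDim R) (N : ℕ) :
    ∀ (S : Finset ι) (a : ι → ℕ) (j : ι) (u : R), ∑ i ∈ S, a i ≤ N → (∀ i ∈ S, 1 ≤ a i) → j ∉ S →
      x j * u ∈ Ideal.span ((fun i => x i ^ a i) '' (S : Set ι)) →
      u ∈ Ideal.span ((fun i => x i ^ a i) '' (S : Set ι)) := by
  induction N with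
  | zero =>
    intro S a j u hN ha hj hu
    have hS : S = ∅ := by
      rw [Finset.eq_empty_iff_forall_notMem]
      intro i hi
      have := Finset.single_le_sum (f := a) (fun _ _ => Nat.zero_le _) hi
      have := ha i hi
      omega
    subst hS
    have hreg := (isRegularLocalRing_quotient_span_image hx hd ∅).1
    have := isDomain_of_isRegularLocalRing (R ⧸ Ideal.span (x '' (∅ : Finset ι)))
    have hp : (Ideal.span (x '' (∅ : Finset ι))).IsPrime :=
      (Ideal.Quotient.isDomain_iff_prime _).mp this
    have hnot := notMem_span_image_of_notMem hx hd hj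
    simp only [Finset.coe_empty, Set.image_empty] at hu hp hnot ⊢
    exact (hp.mem_or_mem hu).resolve_left hnot
  | succ N ih =>
    intro S a j u hN ha hj hu
    by_cases hall : ∀ i ∈ S, a i = 1
    · have himg : (fun i => x i ^ a i) '' (S : Set ι) = x '' S :=
        Set.image_congr fun i hi => by rw [hall i hi, pow_one]
      rw [himg] at hu ⊢
      have hreg := (isRegularLocalRing_quotient_span_image hx hd S).1
      have := isDomain_of_isRegularLocalRing (R ⧸ Ideal.span (x '' S))
      have hp : (Ideal.span (x '' S)).IsPrime := (Ideal.Quotient.isDomain_iff_prime _).mp this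
      exact (hp.mem_or_mem hu).resolve_left (notMem_span_image_of_notMem hx hd hj)
    · push Not at hall
      obtain ⟨k, hk, hk1⟩ := hall
      obtain ⟨c, hc⟩ : ∃ c, a k = c + 2 := ⟨a k - 2, by have := ha k hk; omega⟩
      have hsum := Finset.add_sum_erase S a hk
      have hupd : ∀ c', 1 ≤ c' → ∀ i ∈ S, 1 ≤ Function.update a k c' i := by
        intro c' hc' i hi
        by_cases h : i = k
        · subst h; rwa [Function.update_self]
        · rw [Function.update_of_ne h]; exact ha i hi
      have hsum' : ∀ c', ∑ i ∈ S, Function.update a k c' i = c' + ∑ i ∈ S.erase k, a i := by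
        intro c'
        rw [← Finset.add_sum_erase S _ hk, Function.update_self]
        congr 1
        exact Finset.sum_congr rfl fun i hi => by
          rw [Function.update_of_ne (Finset.ne_of_mem_erase hi)]
      have hself := span_pow_image_eq_sup x a hk (c + 2)
      rw [← hc, Function.update_eq_self, hc] at hself
      set I := Ideal.span ((fun i => x i ^ a i) '' (S.erase k : Finset ι)) with hI
      have hmul : ∀ (m : ℕ) (v : R), x k ^ m * v ∈ I → v ∈ I := by
        intro m
        induction m with
        | zero => intro v hv; simpa using hv
        | succ m ihm =>
          intro v hv
          refine ihm v (ih (S.erase k) a k _ (by omega)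
            (fun i hi => ha i (Finset.mem_of_mem_erase hi)) (Finset.notMem_erase k S) ?_)
          rw [← mul_assoc, ← pow_succ']
          exact hv
      -- first divide by `x j` modulo a smaller power of `x k`
      have h1 : u ∈ Ideal.span {x k ^ (c + 1)} ⊔ I := by
        rw [← span_pow_image_eq_sup x a hk (c + 1)]
        refine ih S _ j u (by rw [hsum']; omega) (hupd _ (by omega)) hj ?_
        rw [span_pow_image_eq_sup x a hk (c + 1)]
        rw [hself] at hu
        have hle : Ideal.span {x k ^ (c + 2)} ≤ Ideal.span {x k ^ (c + 1)} :=
          Ideal.span_singleton_le_span_singleton.mpr (pow_dvd_pow _ (by omega))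
        exact (sup_le_sup_right hle I : _ ≤ _) hu
      obtain ⟨v, w, hw, rfl⟩ := Ideal.mem_span_singleton_sup.mp h1
      rw [hself] at hu
      obtain ⟨r, w', hw', h2⟩ := Ideal.mem_span_singleton_sup.mp hu
      have h3 : x j * v - r * x k ∈ I := by
        refine hmul (c + 1) _ ?_
        have : x k ^ (c + 1) * (x j * v - r * x k) = w' - x j * w := by
          linear_combination -h2
        rw [this]
        exact sub_mem hw' (I.mul_mem_left _ hw)
      have h4 : v ∈ Ideal.span {x k ^ 1} ⊔ I := by
        rw [← span_pow_image_eq_sup x a hk 1]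
        refine ih S _ j v (by rw [hsum']; omega) (hupd _ le_rfl) hj ?_
        rw [span_pow_image_eq_sup x a hk 1, pow_one]
        exact Ideal.mem_span_singleton_sup.mpr ⟨r, _, h3, by ring⟩
      obtain ⟨s, w'', hw'', rfl⟩ := Ideal.mem_span_singleton_sup.mp h4
      rw [hself]
      refine Ideal.mem_span_singleton_sup.mpr ⟨s, x k ^ (c + 1) * w'' + w,
        add_mem (I.mul_mem_left _ hw'') hw, by ring⟩

/-- The monomial property of a regular system of parameters. -/
lemma prod_pow_notMem_span_pow (hx : Ideal.span (Set.range x) = maximalIdeal R)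
    (hd : ((Fintype.card ι : ℕ) : WithBot ℕ∞) ≤ ringKrullDim R) (N : ℕ) :
    ∀ a : ι → ℕ, ∑ i, a i ≤ N →
      ∏ i, x i ^ a i ∉ Ideal.span (Set.range fun i => x i ^ (a i + 1)) := by
  have hrange : ∀ a : ι → ℕ, Set.range (fun i => x i ^ (a i + 1)) =
      (fun i => x i ^ (a i + 1)) '' (Finset.univ : Finset ι) := fun a => by simp
  induction N with
  | zero =>
    intro a hN h
    have ha : ∀ i, a i = 0 := fun i =>
      Nat.eq_zero_of_le_zero ((Finset.single_le_sum (f := a) (fun _ _ => Nat.zero_le _)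
        (Finset.mem_univ i)).trans hN)
    simp only [ha, pow_zero, Finset.prod_const_one, zero_add, pow_one, hx] at h
    exact (Ideal.ne_top_iff_one _).mp (Ideal.IsPrime.ne_top inferInstance) h
  | succ N ih =>
    intro a hN h
    by_cases hall : ∀ i, a i = 0
    · exact ih a (by simp [hall]) h
    · push Not at hall
      obtain ⟨k, hk⟩ := hall
      obtain ⟨c, hc⟩ := Nat.exists_eq_succ_of_ne_zero hk
      have hku : k ∈ (Finset.univ : Finset ι) := Finset.mem_univ k
      have hsum := Finset.add_sum_erase Finset.univ a hku
      set I := Ideal.span ((fun i => x i ^ (a i + 1)) '' (Finset.univ.erase k : Finset ι)) with hI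
      have hsup : ∀ c', Ideal.span (Set.range fun i => x i ^ (Function.update a k c' i + 1)) =
          Ideal.span {x k ^ (c' + 1)} ⊔ I := by
        intro c'
        rw [hI, ← span_pow_image_eq_sup x (fun i => a i + 1) hku (c' + 1), hrange]
        congr 1
        refine Set.image_congr fun i _ => ?_
        by_cases hi : i = k
        · subst hi; simp
        · simp [Function.update_of_ne hi]
      have hprod : ∀ c', ∏ i, x i ^ Function.update a k c' i =
          x k ^ c' * ∏ i ∈ Finset.univ.erase k, x i ^ a i := by
        intro c'
        rw [← Finset.mul_prod_erase Finset.univ _ hku, Function.update_self]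
        congr 1
        exact Finset.prod_congr rfl fun i hi => by
          rw [Function.update_of_ne (Finset.ne_of_mem_erase hi)]
      have hself := hsup (c + 1)
      have hpself := hprod (c + 1)
      rw [← Nat.succ_eq_add_one, ← hc, Function.update_eq_self, hc] at hself hpself
      rw [hself, hpself] at h
      obtain ⟨r, w, hw, h2⟩ := Ideal.mem_span_singleton_sup.mp h
      set m := ∏ i ∈ Finset.univ.erase k, x i ^ a i
      have h3 : x k * (x k ^ c * m - r * x k ^ (c + 1)) ∈ I := by
        have : x k * (x k ^ c * m - r * x k ^ (c + 1)) = w := by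
          rw [Nat.succ_eq_add_one] at h2
          linear_combination -h2
        rwa [this]
      have h4 := mem_span_pow_of_mul_mem hx hd _ (Finset.univ.erase k) (fun i => a i + 1) k _
        le_rfl (fun i _ => Nat.le_add_left 1 _) (Finset.notMem_erase k _) h3
      refine ih (Function.update a k c) ?_ ?_
      · rw [← Finset.add_sum_erase Finset.univ _ hku, Function.update_self]
        have : ∑ i ∈ Finset.univ.erase k, Function.update a k c i =
            ∑ i ∈ Finset.univ.erase k, a i :=
          Finset.sum_congr rfl fun i hi => by
            rw [Function.update_of_ne (Finset.ne_of_mem_erase hi)]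
        omega
      · rw [hsup, hprod]
        exact Ideal.mem_span_singleton_sup.mpr ⟨r, _, h4, by ring⟩

end Monomials

end RegularLocalRings

/-! ### Coefficient fields -/

section CoefficientFields

open Polynomial

variable {k P : Type*} [Field k] [CommRing P] (p : ℕ) [hp : Fact p.Prime]

/-- A subring of `P` that contains all `p`-th powers and is maximal among those that meet the kernel
of `f` trivially is a field mapping onto `k`: adjoining a lift `b` of an element `θ` outside its
image `K` would give a larger such subring, because `X ^ p - θ ^ p` is the minimal polynomial of
`θ`. -/
lemma surjective_of_maximal_subring [CharP P p] (f : P →+* k) (hf : Function.Surjective f)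
    (Γ : Subring P)
    (hΓ : Maximal (· ∈ {Γ : Subring P | (∀ x, x ^ p ∈ Γ) ∧ ∀ x ∈ Γ, f x = 0 → x = 0}) Γ) :
    ∀ θ : k, ∃ x ∈ Γ, f x = θ := by
  obtain ⟨⟨hpow, hinj⟩, hmax⟩ := hΓ
  by_contra! hcon
  obtain ⟨θ, hθ⟩ := hcon
  obtain ⟨b, rfl⟩ := hf θ
  let K : Subfield k :=
    { Γ.map f with
      inv_mem' := by
        rintro _ ⟨x, hx, rfl⟩
        obtain ⟨z, hz⟩ := hf (f x)⁻¹
        rcases eq_or_ne (f x) 0 with h0 | h0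
        · exact ⟨0, Γ.zero_mem, by simp [h0]⟩
        · refine ⟨x ^ (p - 1) * z ^ p, Γ.mul_mem (Γ.pow_mem hx _) (hpow z), ?_⟩
          obtain ⟨m, hm⟩ := Nat.exists_eq_succ_of_ne_zero hp.out.ne_zero
          rw [map_mul, map_pow, map_pow, hz, hm, Nat.succ_sub_one, pow_succ, ← mul_assoc, ← mul_pow,
            mul_inv_cancel₀ h0, one_pow, one_mul] }
  let φ : Γ →+* K := (f.comp Γ.subtype).codRestrict K fun x => ⟨x, x.2, rfl⟩
  have hφ : Function.Injective φ := by
    rw [injective_iff_map_eq_zero]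
    intro x hx
    exact Subtype.ext (hinj x x.2 (congrArg Subtype.val hx))
  have : Nontrivial Γ := φ.domain_nontrivial
  have : CharP k p := by
    rw [CharP.charP_iff_prime_eq_zero hp.out, ← map_natCast f, CharP.cast_eq_zero, map_zero]
  let g₀ : Γ[X] := X ^ p - C ⟨b ^ p, hpow b⟩
  have hg₀ : g₀.Monic := monic_X_pow_sub_C _ hp.out.ne_zero
  have hirr : Irreducible (X ^ p - C (φ ⟨b ^ p, hpow b⟩) : K[X]) := by
    refine X_pow_sub_C_irreducible_of_prime hp.out ?_
    rintro ⟨_, x, hx, rfl⟩ h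
    have h1 : f x ^ p = f b ^ p := by
      rw [← map_pow f b]
      exact congrArg Subtype.val h
    exact hθ x hx (frobenius_inj k p h1)
  have hmin : minpoly K (f b) = X ^ p - C (φ ⟨b ^ p, hpow b⟩) := by
    symm
    refine minpoly.eq_of_irreducible_of_monic hirr ?_ (monic_X_pow_sub_C _ hp.out.ne_zero)
    rw [map_sub, map_pow, aeval_X, aeval_C, ← map_pow]
    exact sub_self _
  have hmem : (Algebra.adjoin Γ {b}).toSubring ∈
      {Γ : Subring P | (∀ x, x ^ p ∈ Γ) ∧ ∀ x ∈ Γ, f x = 0 → x = 0} := by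
    refine ⟨fun x => (Algebra.adjoin Γ {b}).algebraMap_mem ⟨x ^ p, hpow x⟩, ?_⟩
    intro x hx hfx
    rw [Subalgebra.mem_toSubring, Algebra.adjoin_singleton_eq_range_aeval] at hx
    obtain ⟨g, rfl⟩ := hx
    have hroot : aeval b g₀ = 0 := by
      rw [map_sub, map_pow, aeval_X, aeval_C]
      exact sub_self _
    change aeval b g = 0
    change f (aeval b g) = 0 at hfx
    rw [← aeval_modByMonic_eq_self_of_root hroot] at hfx ⊢
    set h := g %ₘ g₀ with hh
    have h1 : aeval (f b) (h.map φ) = 0 := by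
      rw [← hfx, aeval_def, aeval_def, eval₂_map, hom_eval₂]
      rfl
    have h2 : h.map φ = 0 := by
      by_contra hne
      have h3 := minpoly.degree_le_of_ne_zero K (f b) hne h1
      rw [hmin, degree_X_pow_sub_C hp.out.pos] at h3
      have h4 : (h.map φ).degree < p := by
        refine degree_map_le.trans_lt ?_
        have := degree_modByMonic_lt g hg₀
        rwa [degree_X_pow_sub_C hp.out.pos] at this
      exact absurd h3 (not_le.mpr h4)
    rw [(Polynomial.map_eq_zero_iff hφ).mp h2, map_zero]
  have hle : Γ ≤ (Algebra.adjoin Γ {b}).toSubring := fun x hx =>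
    (Algebra.adjoin Γ {b}).algebraMap_mem ⟨x, hx⟩
  exact hθ b (hmax hmem hle (Algebra.self_mem_adjoin_singleton Γ b)) rfl

/-- A surjection onto a field of characteristic `p` whose kernel is annihilated by Frobenius has a
section. -/
lemma exists_section_of_pow_eq_zero [CharP P p] (f : P →+* k) (hf : Function.Surjective f)
    (hker : ∀ x, f x = 0 → x ^ p = 0) : ∃ s : k →+* P, ∀ a, f (s a) = a := by
  have hbase : (frobenius P p).range ∈
      {Γ : Subring P | (∀ x, x ^ p ∈ Γ) ∧ ∀ x ∈ Γ, f x = 0 → x = 0} := by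
    refine ⟨fun x => ⟨x, rfl⟩, ?_⟩
    rintro _ ⟨x, rfl⟩ h
    rw [frobenius_def, map_pow] at h
    exact hker x (pow_eq_zero_iff hp.out.ne_zero |>.mp h)
  obtain ⟨Γ, -, hΓ⟩ := zorn_le_nonempty₀ _ (fun c hc hchain y hy => by
    have hdir := hchain.directedOn
    refine ⟨sSup c, ⟨fun x => ?_, fun x hx => ?_⟩, fun z hz => le_sSup hz⟩
    · exact le_sSup hy ((hc hy).1 x)
    · obtain ⟨Γ, hΓ, hx⟩ := (Subring.mem_sSup_of_directedOn ⟨y, hy⟩ hdir).mp hx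
      exact (hc hΓ).2 x hx) _ hbase
  have hsurj := surjective_of_maximal_subring p f hf Γ hΓ
  let φ : Γ →+* k := f.comp Γ.subtype
  have hφ : Function.Bijective φ := by
    refine ⟨(injective_iff_map_eq_zero φ).mpr fun x hx => Subtype.ext (hΓ.1.2 x x.2 hx), ?_⟩
    intro a
    obtain ⟨x, hx, rfl⟩ := hsurj a
    exact ⟨⟨x, hx⟩, rfl⟩
  let e := RingEquiv.ofBijective φ hφ
  exact ⟨Γ.subtype.comp e.symm.toRingHom, fun a => e.apply_symm_apply a⟩

/-- Ring homomorphisms from a field of characteristic `p` lift along surjections whose kernel is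
annihilated by Frobenius. -/
lemma exists_lift_of_pow_eq_zero {B C : Type*} [CommRing B] [CommRing C] [Nontrivial C]
    [CharP B p] (π : B →+* C) (hπ : Function.Surjective π) (hker : ∀ x, π x = 0 → x ^ p = 0)
    (s : k →+* C) :
    ∃ s' : k →+* B, ∀ a, π (s' a) = s a := by
  let Q : Subring (k × B) :=
    RingHom.eqLocus (s.comp (RingHom.fst k B)) (π.comp (RingHom.snd k B))
  let f : Q →+* k := (RingHom.fst k B).comp Q.subtype
  have hf : Function.Surjective f := by
    intro a
    obtain ⟨b, hb⟩ := hπ (s a)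
    exact ⟨⟨(a, b), hb.symm⟩, rfl⟩
  have : Nontrivial Q := hf.nontrivial
  have hk : CharP k p := by
    rw [CharP.charP_iff_prime_eq_zero hp.out]
    apply s.injective
    have h1 : (p : C) = 0 := by rw [← map_natCast π, CharP.cast_eq_zero, map_zero]
    rw [map_natCast, h1, map_zero]
  have : CharP Q p := by
    rw [CharP.charP_iff_prime_eq_zero hp.out]
    refine Subtype.ext (Prod.ext ?_ ?_)
    · simp
    · simp
  obtain ⟨t, ht⟩ := exists_section_of_pow_eq_zero p f hf (by
    rintro ⟨⟨a, b⟩, hab⟩ (rfl : a = 0)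
    have h1 : π b = 0 := by
      have h2 : s 0 = π b := hab
      rw [← h2, map_zero]
    refine Subtype.ext (Prod.ext ?_ (hker b h1))
    exact zero_pow hp.out.ne_zero)
  refine ⟨(RingHom.snd k B).comp (Q.subtype.comp t), fun a => ?_⟩
  have h1 : s (t a).1.1 = π (t a).1.2 := (t a).2
  have h2 : (t a).1.1 = a := ht a
  rw [h2] at h1
  exact h1.symm

/-- Existence of a coefficient field. The section is lifted through the quotients by the kernels of
the powers of Frobenius. -/
lemma exists_section_of_pow_pow_eq_zero (e : ℕ) : ∀ {B : Type u} [CommRing B] [CharP B p]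
    (π : B →+* k), Function.Surjective π → (∀ x, π x = 0 → x ^ p ^ e = 0) →
    ∃ s : k →+* B, ∀ a, π (s a) = a := by
  induction e with
  | zero =>
    intro B _ _ π hπ hker
    exact exists_section_of_pow_eq_zero p π hπ fun x hx => by
      have := hker x hx
      rw [pow_zero, pow_one] at this
      rw [this, zero_pow hp.out.ne_zero]
  | succ e ih =>
    intro B _ _ π hπ hker
    let I : Ideal B := RingHom.ker (frobenius B p)
    have hI : ∀ x ∈ I, x ^ p = 0 := fun x hx => hx
    have hIπ : ∀ x ∈ I, π x = 0 := fun x hx => by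
      have := congrArg π (hI x hx)
      rw [map_pow, map_zero] at this
      exact (pow_eq_zero_iff hp.out.ne_zero).mp this
    let π' : B ⧸ I →+* k := Ideal.Quotient.lift I π hIπ
    have hπ' : Function.Surjective π' := fun a => by
      obtain ⟨b, hb⟩ := hπ a
      exact ⟨Ideal.Quotient.mk I b, hb⟩
    have : Nontrivial (B ⧸ I) := hπ'.nontrivial
    have : CharP (B ⧸ I) p := by
      rw [CharP.charP_iff_prime_eq_zero hp.out, ← map_natCast (Ideal.Quotient.mk I),
        CharP.cast_eq_zero, map_zero]
    obtain ⟨s, hs⟩ := ih π' hπ' (by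
      intro x hx
      obtain ⟨b, rfl⟩ := Ideal.Quotient.mk_surjective x
      rw [← map_pow, Ideal.Quotient.eq_zero_iff_mem]
      change frobenius B p (b ^ p ^ e) = 0
      rw [frobenius_def, ← pow_mul, ← pow_succ]
      exact hker b hx)
    obtain ⟨s', hs'⟩ := exists_lift_of_pow_eq_zero p (Ideal.Quotient.mk I)
      Ideal.Quotient.mk_surjective (fun x hx => hI x (Ideal.Quotient.eq_zero_iff_mem.mp hx)) s
    refine ⟨s', fun a => ?_⟩
    calc π (s' a) = π' (Ideal.Quotient.mk I (s' a)) := rfl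
      _ = a := by rw [hs', hs]

end CoefficientFields

/-! ### Truncated polynomial rings -/

section TruncatedPolynomials

open MvPolynomial

variable {σ τ k L : Type*} [Field k] [Field L]

lemma mem_idealOfVars_iff_constantCoeff {f : MvPolynomial σ k} :
    f ∈ idealOfVars σ k ↔ constantCoeff f = 0 := by
  rw [← pow_one (idealOfVars σ k), mem_pow_idealOfVars_iff']
  constructor
  · intro h
    exact h 0 (by simp)
  · intro h m hm
    rw [Nat.lt_one_iff, Finsupp.degree_eq_zero_iff] at hm
    rw [hm]
    exact h

lemma powIdeal_idealOfVars_eq (p : ℕ) [ExpChar k p] (e : ℕ) :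
    powIdeal (idealOfVars σ k) (p ^ e) =
      Ideal.span
        ((fun m => monomial m (1 : k)) '' Set.range fun i => Finsupp.single i (p ^ e)) := by
  rw [idealOfVars, powIdeal_span, ← Set.range_comp, ← Set.range_comp]
  congr 2
  ext i : 1
  simp [X_pow_eq_monomial]

lemma mem_powIdeal_idealOfVars (p : ℕ) [ExpChar k p] {e : ℕ} {f : MvPolynomial σ k} :
    f ∈ powIdeal (idealOfVars σ k) (p ^ e) ↔ ∀ m ∈ f.support, ∃ i, p ^ e ≤ m i := by
  rw [powIdeal_idealOfVars_eq, mem_ideal_span_monomial_image]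
  simp

/-- Membership in a Frobenius power of the ideal of the origin does not change under field
extensions and the adjunction of variables. -/
lemma map_rename_mem_powIdeal_idealOfVars (p : ℕ) [ExpChar k p] [ExpChar L p] (φ : k →+* L)
    {v : σ → τ} (hv : Function.Injective v) {e : ℕ} {f : MvPolynomial σ k} :
    MvPolynomial.map φ (rename v f) ∈ powIdeal (idealOfVars τ L) (p ^ e) ↔
      f ∈ powIdeal (idealOfVars σ k) (p ^ e) := by
  classical
  have hq : 0 < p ^ e := pow_pos (expChar_pos k p) e
  rw [mem_powIdeal_idealOfVars, mem_powIdeal_idealOfVars, support_map_of_injective _ φ.injective,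
    support_rename_of_injective hv, Finset.forall_mem_image]
  refine forall₂_congr fun m _ => ⟨?_, ?_⟩
  · rintro ⟨i, hi⟩
    by_cases h : i ∈ Set.range v
    · obtain ⟨j, rfl⟩ := h
      rw [Finsupp.mapDomain_apply hv] at hi
      exact ⟨j, hi⟩
    · rw [Finsupp.mapDomain_of_notMem_range _ _ h] at hi
      omega
  · rintro ⟨i, hi⟩
    exact ⟨v i, by rwa [Finsupp.mapDomain_apply hv]⟩

variable {B : Type*} [CommRing B]

/-- If the product of the `y i ^ (q - 1)` does not vanish, then all polynomial relations between the
`y i` follow from `y i ^ q = 0`: multiplying a relation by a suitable monomial isolates its lowest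
term. -/
lemma ker_eval₂Hom_eq_powIdeal [Fintype σ] (p : ℕ) [ExpChar k p] {e : ℕ} (s : k →+* B) (y : σ → B)
    (hy : ∀ i, y i ^ p ^ e = 0) (hprod : ∏ i, y i ^ (p ^ e - 1) ≠ 0) :
    RingHom.ker (eval₂Hom s y) = powIdeal (idealOfVars σ k) (p ^ e) := by
  have hq : 0 < p ^ e := pow_pos (expChar_pos k p) e
  apply le_antisymm
  · intro f hf
    rw [RingHom.mem_ker] at hf
    by_contra hnot
    rw [mem_powIdeal_idealOfVars] at hnot
    push Not at hnot
    obtain ⟨α₁, hα₁, hlt₁⟩ := hnot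
    obtain ⟨α, hα, hmin⟩ := Finset.exists_min_image
      (f.support.filter fun m => ∀ i, m i < p ^ e) Finsupp.degree
      ⟨α₁, Finset.mem_filter.mpr ⟨hα₁, hlt₁⟩⟩
    obtain ⟨hα, hlt⟩ := Finset.mem_filter.mp hα
    have h0 : eval₂Hom s y f * ∏ i, y i ^ (p ^ e - 1 - α i) = 0 := by rw [hf, zero_mul]
    rw [coe_eval₂Hom, eval₂_eq', Finset.sum_mul, Finset.sum_eq_single α] at h0
    · rw [mul_assoc, ← Finset.prod_mul_distrib] at h0
      have h1 : ∏ i, y i ^ α i * y i ^ (p ^ e - 1 - α i) = ∏ i, y i ^ (p ^ e - 1) := by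
        refine Finset.prod_congr rfl fun i _ => ?_
        rw [← pow_add]
        congr 1
        have := hlt i
        omega
      rw [h1] at h0
      have hu : IsUnit (s (coeff α f)) := (Ne.isUnit (mem_support_iff.mp hα)).map s
      exact hprod ((hu.mul_right_eq_zero).mp h0)
    · intro β hβ hne
      rw [mul_assoc, ← Finset.prod_mul_distrib]
      have hex : ∃ i, α i < β i := by
        by_contra! hle
        have h2 : ∀ i, β i < p ^ e := fun i => (hle i).trans_lt (hlt i)
        have h3 := hmin β (Finset.mem_filter.mpr ⟨hβ, h2⟩)
        have h4 : β ≤ α := hle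
        obtain ⟨γ, rfl⟩ := le_iff_exists_add.mp h4
        rw [map_add] at h3
        have h5 : Finsupp.degree γ = 0 := by omega
        rw [Finsupp.degree_eq_zero_iff] at h5
        exact hne (by rw [h5, add_zero])
      obtain ⟨i, hi⟩ := hex
      rw [Finset.prod_eq_zero (Finset.mem_univ i), mul_zero]
      rw [← pow_add]
      refine pow_eq_zero_of_le ?_ (hy i)
      have := hlt i
      omega
    · exact fun h => (h hα).elim
  · rw [idealOfVars, powIdeal_span, Ideal.span_le]
    rintro _ ⟨_, ⟨i, rfl⟩, rfl⟩
    simp [RingHom.mem_ker, hy]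

/-- Generation of a ring with nilpotent maximal ideal by a coefficient field and generators of the
maximal ideal. -/
lemma surjective_eval₂Hom {N : ℕ} (π : B →+* k) (s : k →+* B) (hs : ∀ a, π (s a) = a) (y : σ → B)
    (hy : RingHom.ker π = Ideal.span (Set.range y)) (hN : RingHom.ker π ^ N = ⊥) :
    Function.Surjective (eval₂Hom s y) := by
  have key : ∀ j : ℕ, ∀ b : B, ∃ f, b - eval₂Hom s y f ∈ RingHom.ker π ^ j := by
    intro j
    induction j with
    | zero => exact fun b => ⟨0, by simp⟩
    | succ j ih =>
      intro b
      have hker : ∀ b ∈ RingHom.ker π ^ j, ∃ f, b - eval₂Hom s y f ∈ RingHom.ker π ^ (j + 1) := by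
        have h1 : RingHom.ker π ^ j =
            Ideal.span (eval₂Hom s y '' (idealOfVars σ k ^ j : Ideal (MvPolynomial σ k))) := by
          have : RingHom.ker π = (idealOfVars σ k).map (eval₂Hom s y) := by
            rw [hy, Ideal.map_span, ← Set.range_comp]
            congr 2
            ext i
            simp
          rw [this, ← Ideal.map_pow]
          rfl
        intro b hb
        rw [h1, Ideal.span] at hb
        induction hb using Submodule.closure_induction with
        | zero => exact ⟨0, by simp⟩
        | add u v _ _ hu hv =>
          obtain ⟨f, hf⟩ := hu
          obtain ⟨g, hg⟩ := hv
          refine ⟨f + g, ?_⟩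
          rw [map_add, add_sub_add_comm]
          exact add_mem hf hg
        | smul_mem c u hu =>
          obtain ⟨g, hg, rfl⟩ := hu
          have hgj : eval₂Hom s y g ∈ RingHom.ker π ^ j := h1 ▸ Ideal.subset_span ⟨g, hg, rfl⟩
          refine ⟨C (π c) * g, ?_⟩
          rw [map_mul, smul_eq_mul, ← sub_mul, mul_comm, pow_succ]
          refine Ideal.mul_mem_mul hgj ?_
          rw [RingHom.mem_ker, map_sub, coe_eval₂Hom, eval₂_C, hs, sub_self]
      obtain ⟨f, hf⟩ := ih b
      obtain ⟨g, hg⟩ := hker _ hf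
      exact ⟨f + g, by rwa [map_add, ← sub_sub]⟩
  intro b
  obtain ⟨f, hf⟩ := key N b
  rw [hN, Ideal.mem_bot, sub_eq_zero] at hf
  exact ⟨f, hf.symm⟩

end TruncatedPolynomials

/-! ### Polynomial models of ideals in regular local rings -/

section PolynomialModels

open MvPolynomial IsLocalRing

/-- Modulo the Frobenius power `m^{[p^e]}` of its maximal ideal, a regular local ring of
characteristic `p` is a truncated polynomial ring over its residue field. -/
lemma exists_surjective_ker_eq_powIdeal (p : ℕ) [hp : Fact p.Prime] {R : Type u} [CommRing R]
    [IsRegularLocalRing R] [CharP R p] {d : ℕ} {x : Fin d → R}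
    (hx : Ideal.span (Set.range x) = maximalIdeal R) (hd : ringKrullDim R = d) (e : ℕ) :
    ∃ (_ : CharP (ResidueField R) p)
      (φ : MvPolynomial (Fin d) (ResidueField R) →+* R ⧸ powIdeal (maximalIdeal R) (p ^ e))
      (π : R ⧸ powIdeal (maximalIdeal R) (p ^ e) →+* ResidueField R),
      Function.Surjective φ ∧
      RingHom.ker φ = powIdeal (idealOfVars (Fin d) (ResidueField R)) (p ^ e) ∧
      (∀ a, π (Ideal.Quotient.mk _ a) = residue R a) ∧ ∀ f, π (φ f) = constantCoeff f := by
  have hq : p ^ e ≠ 0 := pow_ne_zero e hp.out.ne_zero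
  set m := maximalIdeal R with hm
  set J := powIdeal m (p ^ e) with hJ
  have hJm : J ≤ m := powIdeal_le_self m hq
  have hCk : CharP (ResidueField R) p := by
    rw [CharP.charP_iff_prime_eq_zero hp.out, ← map_natCast (residue R), CharP.cast_eq_zero,
      map_zero]
  let π : R ⧸ J →+* ResidueField R := Ideal.Quotient.lift J (residue R) fun a ha =>
    (residue_eq_zero_iff a).mpr (hJm ha)
  have hπ : Function.Surjective π := fun a => by
    obtain ⟨b, hb⟩ := residue_surjective a
    exact ⟨Ideal.Quotient.mk J b, hb⟩
  have hnt : Nontrivial (R ⧸ J) := hπ.nontrivial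
  have hCB : CharP (R ⧸ J) p := by
    rw [CharP.charP_iff_prime_eq_zero hp.out, ← map_natCast (Ideal.Quotient.mk J),
      CharP.cast_eq_zero, map_zero]
  have hker : RingHom.ker π = m.map (Ideal.Quotient.mk J) := by
    ext b
    obtain ⟨a, rfl⟩ := Ideal.Quotient.mk_surjective b
    rw [Ideal.mem_map_iff_of_surjective _ Ideal.Quotient.mk_surjective]
    constructor
    · exact fun h => ⟨a, (residue_eq_zero_iff a).mp h, rfl⟩
    · rintro ⟨a', ha', h⟩
      rw [← h]
      exact (residue_eq_zero_iff a').mpr ha'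
  obtain ⟨s, hs⟩ := exists_section_of_pow_pow_eq_zero p e π hπ (by
    intro b hb
    obtain ⟨a, rfl⟩ := Ideal.Quotient.mk_surjective b
    rw [← map_pow, Ideal.Quotient.eq_zero_iff_mem]
    exact pow_mem_powIdeal ((residue_eq_zero_iff a).mp hb) _)
  let y : Fin d → R ⧸ J := fun i => Ideal.Quotient.mk J (x i)
  have hxm : ∀ i, x i ∈ m := fun i => hx ▸ Ideal.subset_span ⟨i, rfl⟩
  have hJspan : J = Ideal.span (Set.range fun i => x i ^ p ^ e) := by
    rw [hJ, ← hx, powIdeal_span, ← Set.range_comp]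
    rfl
  refine ⟨hCk, eval₂Hom s y, π, ?_, ?_, fun a => rfl, fun f => ?_⟩
  · obtain ⟨t, ht⟩ := m.fg_of_isNoetherianRing
    refine surjective_eval₂Hom (N := (1 + t.card) * p ^ e) π s hs y ?_ ?_
    · rw [hker, ← hx, Ideal.map_span, ← Set.range_comp]
      rfl
    · rw [hker, ← Ideal.map_pow, ← le_bot_iff, Ideal.map_le_iff_le_comap]
      have := pow_le_powIdeal_self p t e
      rw [ht] at this
      intro a ha
      rw [Ideal.mem_comap, Ideal.mem_bot, Ideal.Quotient.eq_zero_iff_mem]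
      exact this ha
  · refine ker_eval₂Hom_eq_powIdeal p s y (fun i => ?_) ?_
    · rw [← map_pow, Ideal.Quotient.eq_zero_iff_mem]
      exact pow_mem_powIdeal (hxm i) _
    · have h1 := prod_pow_notMem_span_pow hx (by rw [hd]; simp) _ (fun _ => p ^ e - 1) le_rfl
      simp only [Nat.sub_add_cancel (Nat.one_le_iff_ne_zero.mpr hq)] at h1
      rw [← hJspan] at h1
      intro h2
      apply h1
      rw [← Ideal.Quotient.eq_zero_iff_mem, map_prod]
      simpa [y] using h2
  · have : π.comp (eval₂Hom s y) = constantCoeff := by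
      refine MvPolynomial.ringHom_ext (fun a => ?_) fun i => ?_
      · simp [hs]
      · simp only [RingHom.comp_apply, coe_eval₂Hom, eval₂_X, constantCoeff_X]
        exact (residue_eq_zero_iff _).mpr (hxm i)
    exact RingHom.congr_fun this f

/-- The containments `a ^ r ≤ m^{[q]}` for an ideal `a` of a regular local ring agree with those for
an ideal of a polynomial ring over an algebraically closed field, as long as `q` is fixed. -/
lemma exists_polynomial_model (p : ℕ) [hp : Fact p.Prime] {R : Type u} [CommRing R]
    [IsRegularLocalRing R] [CharP R p] {n : ℕ} (hn : ringKrullDim R ≤ n) (t : Finset R)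
    (ht : Ideal.span (t : Set R) ≤ maximalIdeal R) (e : ℕ) :
    ∃ (L : Type u) (_ : Field L) (_ : IsAlgClosed L) (_ : CharP L p)
      (w : Finset (MvPolynomial (Fin n) L)), w.card ≤ t.card ∧
        Ideal.span (w : Set (MvPolynomial (Fin n) L)) ≤ idealOfVars (Fin n) L ∧
        ∀ r, Ideal.span (w : Set (MvPolynomial (Fin n) L)) ^ r ≤
            powIdeal (idealOfVars (Fin n) L) (p ^ e) ↔
          Ideal.span (t : Set R) ^ r ≤ powIdeal (maximalIdeal R) (p ^ e) := by
  classical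
  obtain ⟨d, x, hx, hd⟩ := exists_span_range_eq_maximalIdeal R
  obtain ⟨hCk, φ, π, hφ, hker, hπ, hπφ⟩ := exists_surjective_ker_eq_powIdeal p hx hd e
  have hdn : d ≤ n := by
    rw [hd] at hn
    exact_mod_cast hn
  set k := ResidueField R
  set L := AlgebraicClosure k
  have hCL : CharP L p := charP_of_injective_algebraMap (algebraMap k L).injective p
  choose g hg using fun f : R => hφ (Ideal.Quotient.mk _ f)
  let ψ : MvPolynomial (Fin d) k →+* MvPolynomial (Fin n) L :=
    (MvPolynomial.map (algebraMap k L)).comp (rename (Fin.castLE hdn)).toRingHom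
  have hψ : ∀ f (e' : ℕ), ψ f ∈ powIdeal (idealOfVars (Fin n) L) (p ^ e') ↔
      f ∈ powIdeal (idealOfVars (Fin d) k) (p ^ e') := fun f e' =>
    map_rename_mem_powIdeal_idealOfVars p (algebraMap k L) (Fin.castLE_injective hdn)
  have hspan : Ideal.span ((t.image fun f => ψ (g f) : Finset _) : Set (MvPolynomial (Fin n) L)) =
      (Ideal.span (g '' t)).map ψ := by
    rw [Ideal.map_span, Finset.coe_image, Set.image_image]
  refine ⟨L, inferInstance, inferInstance, hCL, t.image fun f => ψ (g f), Finset.card_image_le,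
    ?_, fun r => ?_⟩
  · rw [hspan, Ideal.map_le_iff_le_comap, Ideal.span_le]
    rintro _ ⟨f, hf, rfl⟩
    have h1 : g f ∈ idealOfVars (Fin d) k := by
      rw [mem_idealOfVars_iff_constantCoeff, ← hπφ, hg, hπ, residue_eq_zero_iff]
      exact ht (Ideal.subset_span hf)
    have h2 := (hψ (g f) 0).mpr (by simpa [powIdeal] using h1)
    simpa [powIdeal] using h2
  · rw [hspan, ← Ideal.map_pow, Ideal.map_le_iff_le_comap]
    have h1 : (powIdeal (idealOfVars (Fin n) L) (p ^ e)).comap ψ = RingHom.ker φ := by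
      ext f
      rw [Ideal.mem_comap, hψ, hker]
    have h2 : (Ideal.span (g '' t)).map φ = (Ideal.span (t : Set R)).map
        (Ideal.Quotient.mk (powIdeal (maximalIdeal R) (p ^ e))) := by
      rw [Ideal.map_span, Ideal.map_span, Set.image_image]
      congr 1
      exact Set.image_congr fun f _ => hg f
    rw [h1, RingHom.ker_eq_comap_bot, ← Ideal.map_le_iff_le_comap, Ideal.map_pow, h2,
      ← Ideal.map_pow, Ideal.map_le_iff_le_comap, ← RingHom.ker_eq_comap_bot, Ideal.mk_ker]

end PolynomialModels

/-! ### Stalks of ideal sheaves -/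

section StalkIdeals

open IsLocalRing

variable {X Y : Scheme.{u}}

/-- The stalk at `x` of an ideal sheaf, as an ideal of the local ring at `x`. The supremum over the
affine open neighbourhoods of `x` avoids a choice: all of them give the same ideal, see
`stalkIdeal_eq`. -/
def stalkIdeal (a : X.IdealSheafData) (x : X) : Ideal (X.presheaf.stalk x) :=
  ⨆ (U : X.affineOpens) (hx : x ∈ U.1), (a.ideal U).map (X.presheaf.germ U.1 x hx).hom

lemma map_germ_eq_of_le (a : X.IdealSheafData) {x : X} {U V : X.affineOpens} (h : U ≤ V)
    (hx : x ∈ U.1) :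
    (a.ideal V).map (X.presheaf.germ V.1 x (h hx)).hom =
      (a.ideal U).map (X.presheaf.germ U.1 x hx).hom := by
  rw [← a.map_ideal h, Ideal.map_map, ← CommRingCat.hom_comp]
  simp only [homOfLE_leOfHom, TopCat.Presheaf.germ_res']

lemma stalkIdeal_eq (a : X.IdealSheafData) {x : X} (U : X.affineOpens) (hx : x ∈ U.1) :
    stalkIdeal a x = (a.ideal U).map (X.presheaf.germ U.1 x hx).hom := by
  refine le_antisymm (iSup₂_le fun V hV => ?_) (le_iSup₂_of_le U hx le_rfl)
  obtain ⟨f, g, hfg, hxf⟩ := exists_basicOpen_le_affine_inter U.2 V.2 x ⟨hx, hV⟩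
  have hWU : X.affineBasicOpen f ≤ U := X.basicOpen_le f
  have hWV : X.affineBasicOpen f ≤ V := hfg.trans_le (X.basicOpen_le g)
  rw [map_germ_eq_of_le a hWV hxf, map_germ_eq_of_le a hWU hxf]

lemma exists_affineOpens_mem (x : X) : ∃ U : X.affineOpens, x ∈ U.1 := by
  obtain ⟨_, ⟨U, hU, rfl⟩, hxU, -⟩ :=
    X.isBasis_affineOpens.exists_subset_of_mem_open (Set.mem_univ x) isOpen_univ
  exact ⟨⟨U, hU⟩, hxU⟩

lemma le_iff_stalkIdeal_le {a b : X.IdealSheafData} :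
    a ≤ b ↔ ∀ x, stalkIdeal a x ≤ stalkIdeal b x := by
  constructor
  · intro h x
    exact iSup₂_mono fun U hU => Ideal.map_mono (h U)
  · intro h U
    rw [U.2.ideal_le_iff]
    intro x hx
    rw [← stalkIdeal_eq a U hx, ← stalkIdeal_eq b U hx]
    exact h x

lemma stalkIdeal_pow (a : X.IdealSheafData) (r : ℕ) (x : X) :
    stalkIdeal (a ^ r) x = stalkIdeal a x ^ r := by
  obtain ⟨U, hU⟩ := exists_affineOpens_mem x
  rw [stalkIdeal_eq _ U hU, stalkIdeal_eq _ U hU, Scheme.IdealSheafData.ideal_pow, Pi.pow_apply,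
    Ideal.map_pow]

lemma stalkIdeal_frobeniusPower (a : X.IdealSheafData) (q : ℕ) (x : X) :
    stalkIdeal (frobeniusPower a q) x = powIdeal (stalkIdeal a x) q := by
  obtain ⟨U, hU⟩ := exists_affineOpens_mem x
  rw [stalkIdeal_eq _ U hU, stalkIdeal_eq _ U hU]
  let := X.presheaf.algebra_section_stalk (⟨x, hU⟩ : U.1)
  have := U.2.isLocalization_stalk ⟨x, hU⟩
  exact map_powIdeal_of_isLocalization (S := X.presheaf.stalk x)
    (U.2.primeIdealOf ⟨x, hU⟩).asIdeal.primeCompl (a.ideal U) q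

lemma mem_support_iff_stalkIdeal_le {a : X.IdealSheafData} {x : X} :
    x ∈ a.support ↔ stalkIdeal a x ≤ maximalIdeal (X.presheaf.stalk x) := by
  obtain ⟨U, hU⟩ := exists_affineOpens_mem x
  rw [stalkIdeal_eq _ U hU, Scheme.IdealSheafData.mem_support_iff_of_mem hU,
    Ideal.map_le_iff_le_comap, Scheme.mem_zeroLocus_iff]
  refine forall₂_congr fun f _ => ?_
  rw [Scheme.mem_basicOpen _ _ _ hU, Ideal.mem_comap, mem_maximalIdeal, mem_nonunits_iff]

lemma stalkIdeal_eq_top {a : X.IdealSheafData} {x : X} (h : x ∉ a.support) :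
    stalkIdeal a x = ⊤ := by
  by_contra hne
  exact h (mem_support_iff_stalkIdeal_le.mpr (le_maximalIdeal hne))

lemma stalkIdeal_vanishingIdeal {x : X} (hx : IsClosed {x}) :
    stalkIdeal (Scheme.IdealSheafData.vanishingIdeal ⟨{x}, hx⟩) x =
      maximalIdeal (X.presheaf.stalk x) := by
  obtain ⟨U, hU⟩ := exists_affineOpens_mem x
  rw [stalkIdeal_eq _ U hU, Scheme.IdealSheafData.vanishingIdeal_ideal]
  have hU' : IsAffineOpen U.1 := U.2
  have h2 : PrimeSpectrum.vanishingIdeal (U.2.fromSpec ⁻¹' ({x} : Set X)) =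
      (U.2.primeIdealOf ⟨x, hU⟩).asIdeal := by
    ext s
    refine (PrimeSpectrum.mem_vanishingIdeal _ _).trans ⟨fun h => ?_, fun h y hy => ?_⟩
    · exact h _ (U.2.fromSpec_primeIdealOf ⟨x, hU⟩)
    · have : y = U.2.primeIdealOf ⟨x, hU⟩ := by
        apply hU'.fromSpec.isOpenEmbedding.injective
        exact Eq.trans hy (U.2.fromSpec_primeIdealOf ⟨x, hU⟩).symm
      rwa [this]
  let := X.presheaf.algebra_section_stalk (⟨x, hU⟩ : U.1)
  have := U.2.isLocalization_stalk ⟨x, hU⟩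
  have h3 := IsLocalization.AtPrime.map_eq_maximalIdeal (U.2.primeIdealOf ⟨x, hU⟩).asIdeal
    (X.presheaf.stalk x)
  rw [← h3]
  exact congrArg _ h2

lemma stalkIdeal_comap (a : Y.IdealSheafData) (f : X ⟶ Y) [IsOpenImmersion f] (x : X) :
    stalkIdeal (a.comap f) x = (stalkIdeal a (f x)).map (f.stalkMap x).hom := by
  obtain ⟨U, hU⟩ := exists_affineOpens_mem x
  let V : Y.affineOpens := ⟨f ''ᵁ U, U.2.image_of_isOpenImmersion f⟩
  have hV : f x ∈ V.1 := ⟨x, hU, rfl⟩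
  rw [stalkIdeal_eq _ U hU, stalkIdeal_eq _ V hV,
    Scheme.IdealSheafData.ideal_comap_of_isOpenImmersion]
  have h1 : (a.ideal V).comap (f.appIso U).inv.hom = (a.ideal V).map (f.appIso U).hom.hom := by
    exact (Ideal.map_symm (f.appIso U.1).commRingCatIsoToRingEquiv.symm).symm
  rw [h1, Ideal.map_map, Ideal.map_map]
  congr 1
  rw [← CommRingCat.hom_comp, ← CommRingCat.hom_comp]
  rw [Scheme.Hom.appIso_hom, Category.assoc, Scheme.Hom.germ_stalkMap]
  erw [TopCat.Presheaf.germ_res]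

end StalkIdeals

/-! ### Test ideals through closed points -/

section TestIdeals

open IsLocalRing

variable {X : Scheme.{u}}

/-- On a quasi-compact scheme the unit ideal sheaf is a compact element of the lattice of ideal
sheaves. -/
lemma exists_eq_top_of_iSup_eq_top [CompactSpace X] {K : ℕ → X.IdealSheafData} (hK : Monotone K)
    (h : ⨆ n, K n = ⊤) : ∃ n, K n = ⊤ := by
  by_contra! hne
  have h1 : (⋂ n, ((K n).support : Set X)).Nonempty := by
    refine IsCompact.nonempty_iInter_of_directed_nonempty_isCompact_isClosed _ ?_ ?_ ?_ ?_
    · intro m n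
      exact ⟨max m n, Scheme.IdealSheafData.support_antitone (hK (le_max_left m n)),
        Scheme.IdealSheafData.support_antitone (hK (le_max_right m n))⟩
    · intro n
      rw [Set.nonempty_iff_ne_empty]
      intro h0
      exact hne n
        ((Scheme.IdealSheafData.support_eq_bot_iff _).mp (TopologicalSpace.Closeds.ext h0))
    · exact fun n => (K n).support.isClosed.isCompact
    · exact fun n => (K n).support.isClosed
  obtain ⟨x, hx⟩ := h1
  have h2 : (⨆ n, K n).support = ⊥ := by rw [h]; rfl
  rw [Scheme.IdealSheafData.support_iSup] at h2
  have h3 : x ∈ (⨅ n, (K n).support : TopologicalSpace.Closeds X) := by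
    rw [← SetLike.mem_coe, TopologicalSpace.Closeds.coe_iInf]
    exact hx
  rw [h2] at h3
  exact h3

lemma testIdeal_eq_top_iff [CompactSpace X] (p : ℕ) (a : X.IdealSheafData) (t : ℝ) :
    testIdeal p a t = ⊤ ↔
      ∃ N : ℕ, ∀ e ≥ N, frobeniusRoot p (a ^ ⌈t * (p : ℝ) ^ e⌉₊) e = ⊤ := by
  rw [testIdeal, Filter.liminf_eq_iSup_iInf_of_nat]
  constructor
  · intro h
    obtain ⟨N, hN⟩ := exists_eq_top_of_iSup_eq_top (fun m n hmn => by
      refine iInf_mono fun e => iInf_mono' fun he => ⟨hmn.trans he, le_rfl⟩) h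
    rw [iInf₂_eq_top] at hN
    exact ⟨N, hN⟩
  · rintro ⟨N, hN⟩
    rw [eq_top_iff]
    exact le_iSup_of_le N (le_iInf₂ fun e he => (hN e he).ge)

/-- The ideal sheaf `a ^ r` is contained in the Frobenius power of a proper ideal sheaf if and only
if it is contained in that of the ideal sheaf of a closed point. This needs neither flatness of
Frobenius nor the existence of a smallest `J` with `a ^ r ≤ J^{[p^e]}`. -/
lemma frobeniusRoot_ne_top_iff [CompactSpace X] (p : ℕ) (a : X.IdealSheafData)
    (r e : ℕ) :
    frobeniusRoot p (a ^ r) e ≠ ⊤ ↔ ∃ x : X, IsClosed {x} ∧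
      stalkIdeal a x ^ r ≤ powIdeal (maximalIdeal (X.presheaf.stalk x)) (p ^ e) := by
  rw [frobeniusRoot, Ne, sInf_eq_top]
  push Not
  constructor
  · rintro ⟨J, hJ, hne⟩
    have hsupp : (J.support : Set X).Nonempty := by
      rw [Set.nonempty_iff_ne_empty]
      intro h0
      exact hne ((Scheme.IdealSheafData.support_eq_bot_iff _).mp (TopologicalSpace.Closeds.ext h0))
    obtain ⟨x, hx, hcl⟩ := J.support.isClosed.exists_closed_singleton hsupp
    refine ⟨x, hcl, ?_⟩
    have h1 := le_iff_stalkIdeal_le.mp hJ x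
    rw [stalkIdeal_pow, stalkIdeal_frobeniusPower] at h1
    exact h1.trans (powIdeal_mono (mem_support_iff_stalkIdeal_le.mp hx) _)
  · rintro ⟨x, hcl, hx⟩
    refine ⟨Scheme.IdealSheafData.vanishingIdeal ⟨{x}, hcl⟩, ?_, ?_⟩
    · refine le_iff_stalkIdeal_le.mpr fun y => ?_
      rw [stalkIdeal_pow, stalkIdeal_frobeniusPower]
      by_cases hy : y = x
      · subst hy
        rwa [stalkIdeal_vanishingIdeal]
      · have h1 : y ∉ (Scheme.IdealSheafData.vanishingIdeal ⟨{x}, hcl⟩).support := by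
          rw [← SetLike.mem_coe, Scheme.IdealSheafData.coe_support_vanishingIdeal]
          exact hy
        rw [stalkIdeal_eq_top h1, powIdeal_top]
        exact le_top
    · intro h
      have h1 := stalkIdeal_vanishingIdeal hcl
      rw [h] at h1
      have h2 : x ∉ (⊤ : X.IdealSheafData).support := fun h => h
      rw [stalkIdeal_eq_top h2] at h1
      exact Ideal.IsPrime.ne_top inferInstance h1.symm

/-- Triviality of test ideals is decided by containments in the local rings at closed points. -/
lemma testIdeal_ne_top_iff [CompactSpace X] (p : ℕ) (a : X.IdealSheafData) (t : ℝ) :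
    testIdeal p a t ≠ ⊤ ↔ ∀ N : ℕ, ∃ e ≥ N, ∃ x : X, IsClosed {x} ∧
      stalkIdeal a x ^ ⌈t * (p : ℝ) ^ e⌉₊ ≤
        powIdeal (maximalIdeal (X.presheaf.stalk x)) (p ^ e) := by
  rw [Ne, testIdeal_eq_top_iff]
  push Not
  refine forall_congr' fun N => exists_congr fun e => and_congr_right fun _ => ?_
  exact frobeniusRoot_ne_top_iff p a _ e

end TestIdeals

/-! ### Ideal sheaves on open subschemes of affine schemes -/

section Spec

open IsLocalRing
variable {R : Type u} [CommRing R]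

lemma inv_ΓSpecIso_comp_germ (P : PrimeSpectrum R) :
    (Scheme.ΓSpecIso (.of R)).inv ≫ (Spec (.of R)).presheaf.germ ⊤ P trivial =
      StructureSheaf.toStalk R P := by
  rw [← Spec.algebraMap_stalkIso_inv]
  ext s
  exact (IsLocalization.algEquiv P.asIdeal.primeCompl
    ((Spec.structureSheaf R).presheaf.stalk P) (Localization.AtPrime P.asIdeal)).symm.commutes s

/-- The local ring of `Spec R` at `x` is the localization of `R`, compatibly with ideals. The prime
ideal `P` is a separate variable since `x` is a point of a scheme, not of `PrimeSpectrum R`. -/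
lemma exists_isLocalization_specStalk (x : Spec (.of R)) (P : PrimeSpectrum R) (hP : x = P) :
    ∃ _ : Algebra R ((Spec (.of R)).presheaf.stalk x),
      IsLocalization.AtPrime ((Spec (.of R)).presheaf.stalk x) P.asIdeal ∧
      ∀ I : Ideal R, stalkIdeal (idealSheaf I) x = I.map (algebraMap R _) := by
  subst hP
  refine ⟨StructureSheaf.stalkAlgebra (R := R) x, StructureSheaf.IsLocalization.to_stalk R x,
    fun I => ?_⟩
  rw [stalkIdeal_eq _ ⟨⊤, isAffineOpen_top _⟩ trivial, idealSheaf,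
    Scheme.IdealSheafData.ofIdealTop_ideal, Ideal.map_map, Ideal.map_map]
  refine congrArg (fun φ : R →+* _ => I.map φ) ?_
  exact congrArg CommRingCat.Hom.hom (inv_ΓSpecIso_comp_germ x)

lemma exists_isLocalization_stalk (V : (Spec (.of R)).Opens) (v : V.toScheme)
    (P : PrimeSpectrum R) (hP : V.ι v = P) :
    ∃ _ : Algebra R (V.toScheme.presheaf.stalk v),
      IsLocalization.AtPrime (V.toScheme.presheaf.stalk v) P.asIdeal ∧
      ∀ I : Ideal R, stalkIdeal ((idealSheaf I).comap V.ι) v = I.map (algebraMap R _) := by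
  obtain ⟨_, h1, h2⟩ := exists_isLocalization_specStalk _ P hP
  let e := (asIso (V.ι.stalkMap v)).commRingCatIsoToRingEquiv
  let _ : Algebra R (V.toScheme.presheaf.stalk v) :=
    ((V.ι.stalkMap v).hom.comp (algebraMap R _)).toAlgebra
  refine ⟨inferInstance, ?_, fun I => ?_⟩
  · exact IsLocalization.isLocalization_of_algEquiv P.asIdeal.primeCompl
      (AlgEquiv.ofRingEquiv (f := e) fun _ => rfl)
  · rw [stalkIdeal_comap, h2, Ideal.map_map]
    rfl

/-- The local containment that governs test ideals, for the restriction of the ideal sheaf of `I`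
to an open subscheme of `Spec R`. -/
theorem stalkIdeal_comap_idealSheaf_pow_le_iff {I : Ideal R} (V : (Spec (.of R)).Opens)
    (v : V.toScheme) (P : PrimeSpectrum R) (hP : V.ι v = P) (r q : ℕ) :
    stalkIdeal ((idealSheaf I).comap V.ι) v ^ r ≤
      powIdeal (maximalIdeal (V.toScheme.presheaf.stalk v)) q ↔
      ∀ u ∈ I ^ r, ∃ s ∉ P.asIdeal, s * u ∈ powIdeal P.asIdeal q := by
  obtain ⟨_, h1, h2⟩ := exists_isLocalization_stalk V v P hP
  rw [h2, map_pow_le_powIdeal_iff P.asIdeal]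

end Spec

/-! ### The local threshold at the origin of affine space -/

section Affine

open MvPolynomial

variable (p : ℕ) {n : ℕ} {L : Type u} [Field L]

lemma mem_asIdeal_origin {f : MvPolynomial (Fin n) L} :
    f ∈ PrimeSpectrum.asIdeal (origin n L) ↔ f ∈ idealOfVars (Fin n) L := by
  rw [mem_idealOfVars_iff_constantCoeff]
  exact Ideal.mem_bot

lemma isClosed_origin : IsClosed {origin n L} := by
  refine (PrimeSpectrum.isClosed_singleton_iff_isMaximal _).mpr ?_
  exact Ideal.comap_isMaximal_of_surjective _ (fun c => ⟨C c, constantCoeff_C _ c⟩)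
    (K := (⊥ : Ideal L)) (H := Ideal.bot_isMaximal)

lemma testIdeal_comap_idealSheaf_ne_top_iff {R : Type u} [CommRing R] [IsNoetherianRing R]
    (I : Ideal R) (V : (Spec (.of R)).Opens) (t : ℝ) :
    testIdeal p ((idealSheaf I).comap V.ι) t ≠ ⊤ ↔
      ∀ N : ℕ, ∃ e ≥ N, ∃ v : V.toScheme, IsClosed {v} ∧
      ∀ u ∈ I ^ ⌈t * (p : ℝ) ^ e⌉₊, ∃ s ∉ PrimeSpectrum.asIdeal (V.ι v),
        s * u ∈ powIdeal (PrimeSpectrum.asIdeal (V.ι v)) (p ^ e) := by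
  have : CompactSpace V.toScheme := by
    have : TopologicalSpace.NoetherianSpace (Spec (CommRingCat.of R)) :=
      inferInstanceAs (TopologicalSpace.NoetherianSpace (PrimeSpectrum R))
    exact isCompact_iff_compactSpace.mp
      (TopologicalSpace.NoetherianSpace.isCompact (V : Set (Spec (CommRingCat.of R))))
  rw [testIdeal_ne_top_iff]
  simp_rw [stalkIdeal_comap_idealSheaf_pow_le_iff V _ _ rfl]

/-- The local `F`-pure threshold at the origin is the threshold with respect to the maximal ideal of
the origin, and it is the global threshold on some open neighbourhood `V` of the origin. For every
neighbourhood the origin itself shows that the threshold is at most this number. For `V` one takes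
the complement of the zeros of a polynomial `g` that lies in all ideals `(b ^ ⌈t * p ^
e⌉)^{[1/p^e]}`, for `t` below the threshold and `e` large, so that none of these ideals vanishes at
a point of `V`. -/
theorem exists_fpt_comap_eq_fptAt [Fact p.Prime] [CharP L p] [IsAlgClosed L]
    {b : Ideal (MvPolynomial (Fin n) L)} (hb : b ≤ idealOfVars (Fin n) L) :
    fptAt p (idealSheaf b) (origin n L) = threshold p b (idealOfVars (Fin n) L) ∧
    ∃ V : (Spec (.of (MvPolynomial (Fin n) L))).Opens, origin n L ∈ V ∧
      fpt p ((idealSheaf b).comap V.ι) = threshold p b (idealOfVars (Fin n) L) := by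
  have hO : PrimeSpectrum.asIdeal (origin n L) = idealOfVars (Fin n) L :=
    Ideal.ext fun f => mem_asIdeal_origin
  have hsub : ∀ V : (Spec (.of (MvPolynomial (Fin n) L))).Opens, origin n L ∈ V →
      thresholdSet p b (idealOfVars (Fin n) L) ⊆
        {t | 0 ≤ t ∧ testIdeal p ((idealSheaf b).comap V.ι) t ≠ ⊤} := by
    rintro V hV t ⟨ht, h⟩
    refine ⟨ht, (testIdeal_comap_idealSheaf_ne_top_iff p b V t).mpr fun N => ?_⟩
    obtain ⟨e, he, hle⟩ := h N
    refine ⟨e, he, ⟨origin n L, hV⟩, ?_, fun u hu => ⟨1, ?_, ?_⟩⟩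
    · have h1 : IsClosed (V.ι ⁻¹' {origin n L}) := isClosed_origin.preimage V.ι.continuous
      convert! h1
      ext v
      exact Subtype.ext_iff
    · exact (Ideal.ne_top_iff_one _).mp (Ideal.IsPrime.ne_top (PrimeSpectrum.isPrime (origin n L)))
    · rw [one_mul]
      change u ∈ powIdeal (PrimeSpectrum.asIdeal (origin n L)) _
      rw [hO]
      exact hle hu
  have hbdd : ∀ V : (Spec (.of (MvPolynomial (Fin n) L))).Opens,
      BddBelow {t | 0 ≤ t ∧ testIdeal p ((idealSheaf b).comap V.ι) t ≠ ⊤} :=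
    fun V => ⟨0, fun t ht => ht.1⟩
  have hne := thresholdSet_nonempty p (idealOfVars_fg (Fin n) L) hb
  have hle : ∀ V : (Spec (.of (MvPolynomial (Fin n) L))).Opens, origin n L ∈ V →
      fpt p ((idealSheaf b).comap V.ι) ≤ threshold p b (idealOfVars (Fin n) L) := fun V hV =>
    csInf_le_csInf (hbdd V) hne (hsub V hV)
  have hMtop : idealOfVars (Fin n) L ≠ ⊤ := hO ▸ (PrimeSpectrum.isPrime (origin n L)).ne_top
  obtain ⟨g, hg, hroot⟩ := exists_forall_mem_rootIdeal p (b := b) hMtop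
  obtain ⟨V, hV⟩ : ∃ V : (Spec (.of (MvPolynomial (Fin n) L))).Opens,
    V = PrimeSpectrum.basicOpen g := ⟨_, rfl⟩
  have hOV : origin n L ∈ V := by
    rw [hV]
    exact fun h => hg (mem_asIdeal_origin.mp h)
  have heq : fpt p ((idealSheaf b).comap V.ι) = threshold p b (idealOfVars (Fin n) L) := by
    refine le_antisymm (hle V hOV) (le_csInf (hne.mono (hsub V hOV)) ?_)
    rintro t ⟨ht, htest⟩
    by_contra! hlt
    obtain ⟨N, hN⟩ := hroot t ht hlt
    obtain ⟨e, he, v, -, hv⟩ := (testIdeal_comap_idealSheaf_ne_top_iff p b V t).mp htest N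
    have : (PrimeSpectrum.asIdeal (V.ι v)).IsPrime := PrimeSpectrum.isPrime (V.ι v)
    have h1 := rootIdeal_le_of_forall_exists_mul_mem p hv (hN e he)
    have h2 : (V.ι v : PrimeSpectrum (MvPolynomial (Fin n) L)) ∈ PrimeSpectrum.basicOpen g :=
      hV.le v.2
    exact h2 h1
  refine ⟨le_antisymm (csSup_le ⟨_, V, hOV, rfl⟩ ?_) ?_, V, hOV, heq⟩
  · rintro _ ⟨W, hW, rfl⟩
    exact hle W hW
  · refine le_csSup ⟨threshold p b (idealOfVars (Fin n) L), ?_⟩ ⟨V, hOV, heq⟩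
    rintro _ ⟨W, hW, rfl⟩
    exact hle W hW

end Affine

/-! ### Dimension of neighbourhoods of the origin -/

section Dimension

lemma ringKrullDim_stalk_le_topologicalKrullDim {X : Scheme.{u}} (x : X) :
    ringKrullDim (X.presheaf.stalk x) ≤ topologicalKrullDim X := by
  rw [ringKrullDim_stalk_eq_coheight, topologicalKrullDim,
    Order.krullDim_eq_of_orderIso (irreducibleSetEquivPoints (α := X))]
  exact Order.coheight_le_krullDim x

open MvPolynomial

variable (n : ℕ) (L : Type u) [Field L]

/-- Translating a point of affine space to the origin. -/
lemma exists_ringEquiv_comap_vanishingIdeal_eq (a : Fin n → L) :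
    ∃ φ : MvPolynomial (Fin n) L ≃+* MvPolynomial (Fin n) L,
      (vanishingIdeal L {a}).comap (φ : MvPolynomial (Fin n) L →+* MvPolynomial (Fin n) L) =
        idealOfVars (Fin n) L := by
  let f : MvPolynomial (Fin n) L →ₐ[L] MvPolynomial (Fin n) L := aeval fun i => X i - C (a i)
  let g : MvPolynomial (Fin n) L →ₐ[L] MvPolynomial (Fin n) L := aeval fun i => X i + C (a i)
  have hfg : f.comp g = AlgHom.id L _ := by
    ext i
    simp [f, g, algHom_C]
  have hgf : g.comp f = AlgHom.id L _ := by
    ext i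
    simp [f, g, algHom_C]
  refine ⟨(AlgEquiv.ofAlgHom f g hfg hgf).toRingEquiv, Ideal.ext fun h => ?_⟩
  rw [Ideal.mem_comap, mem_vanishingIdeal_singleton_iff, mem_idealOfVars_iff_constantCoeff]
  change aeval a (f h) = 0 ↔ _
  have h1 : (aeval a).comp f = aeval (0 : Fin n → L) := by
    ext i
    simp [f]
  have h2 : aeval a (f h) = aeval (0 : Fin n → L) h := DFunLike.congr_fun h1 h
  rw [h2, aeval_zero]
  rfl

/-- Some maximal ideal has maximal height. It is the ideal of a point, which a translation moves to
the origin. -/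
lemma height_idealOfVars [IsAlgClosed L] : (idealOfVars (Fin n) L).height = n := by
  have hdim : ringKrullDim (MvPolynomial (Fin n) L) = n := by
    rw [ringKrullDim_of_isNoetherianRing, ringKrullDim_eq_zero_of_field]
    simp
  have : FiniteRingKrullDim (MvPolynomial (Fin n) L) := by
    rw [finiteRingKrullDim_iff_ne_bot_and_top, hdim]
    exact ⟨WithBot.coe_ne_bot, fun h => ENat.natCast_ne_top n (WithBot.coe_injective h)⟩
  obtain ⟨m, hm, hh⟩ := Ideal.exists_isMaximal_height (R := MvPolynomial (Fin n) L)
  obtain ⟨a, rfl⟩ := isMaximal_iff_eq_vanishingIdeal_singleton.mp hm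
  obtain ⟨φ, hφ⟩ := exists_ringEquiv_comap_vanishingIdeal_eq n L a
  have h1 : (idealOfVars (Fin n) L).height = (vanishingIdeal L {a}).height :=
    hφ ▸ RingEquiv.height_comap φ (vanishingIdeal L {a})
  rw [h1]
  rw [hdim] at hh
  exact_mod_cast hh

lemma topologicalKrullDim_of_origin_mem [IsAlgClosed L]
    (V : (Spec (.of (MvPolynomial (Fin n) L))).Opens) (hV : origin n L ∈ V) :
    topologicalKrullDim V.toScheme = n := by
  refine le_antisymm ?_ ?_
  · refine V.ι.isOpenEmbedding.isInducing.topologicalKrullDim_le.trans ?_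
    refine (PrimeSpectrum.topologicalKrullDim_eq_ringKrullDim (MvPolynomial (Fin n) L)).trans_le ?_
    rw [ringKrullDim_of_isNoetherianRing, ringKrullDim_eq_zero_of_field]
    simp
  · have := PrimeSpectrum.isPrime (origin n L)
    obtain ⟨_, h1, -⟩ := exists_isLocalization_stalk V ⟨origin n L, hV⟩ (origin n L) rfl
    refine le_trans (le_of_eq ?_)
      (ringKrullDim_stalk_le_topologicalKrullDim (⟨origin n L, hV⟩ : V.toScheme))
    rw [IsLocalization.AtPrime.ringKrullDim_eq_height (PrimeSpectrum.asIdeal (origin n L)),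
      show PrimeSpectrum.asIdeal (origin n L) = idealOfVars (Fin n) L from
        Ideal.ext fun f => mem_asIdeal_origin, height_idealOfVars]
    rfl

end Dimension

/-! ### Finiteness of Frobenius -/

section FFinite

/-- The Frobenius of an algebra of finite type over a perfect field is integral, and it is of finite
type because it restricts to a bijection on the field. -/
lemma isFFinite_of_locallyOfFiniteType (p : ℕ) [Fact p.Prime] {L : Type u} [Field L]
    [CharP L p] [PerfectField L] {W : Scheme.{u}} (f : W ⟶ Spec (.of L)) [LocallyOfFiniteType f] :
    IsFFinite p W := by
  intro U
  let ψ : L →+* Γ(W, U) := (f.appLE ⊤ U le_top).hom.comp (Scheme.ΓSpecIso (.of L)).inv.hom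
  have hψ : ψ.FiniteType := by
    refine (f.finiteType_appLE (isAffineOpen_top _) U.2 le_top).comp
      (RingHom.FiniteType.of_surjective _ ?_)
    exact (Scheme.ΓSpecIso (.of L)).symm.commRingCatIsoToRingEquiv.surjective
  rcases subsingleton_or_nontrivial Γ(W, U) with _ | _
  · exact ⟨RingHom.id _, fun _ => Subsingleton.elim _ _, RingHom.Finite.id _⟩
  have : CharP Γ(W, U) p := charP_of_injective_ringHom ψ.injective p
  have : PerfectRing L p := PerfectField.toPerfectRing p
  refine ⟨frobenius _ p, frobenius_def p, RingHom.IsIntegral.to_finite (fun b => ?_) ?_⟩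
  · exact ⟨Polynomial.X ^ p - Polynomial.C b,
      Polynomial.monic_X_pow_sub_C b (Fact.out : p.Prime).ne_zero, by
        simp [Polynomial.eval₂_sub, frobenius_def]⟩
  · refine RingHom.FiniteType.of_comp_finiteType (f := ψ) ?_
    have h1 : (frobenius Γ(W, U) p).comp ψ = ψ.comp (frobenius L p) :=
      RingHom.ext fun c => (ψ.map_frobenius p c).symm
    rw [h1]
    exact hψ.comp (RingHom.FiniteType.of_surjective _ (bijective_frobenius L p).surjective)

end FFinite

/-! ### Neighbourhoods of the origin as global examples -/

section Membership

open MvPolynomial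

variable (p : ℕ) {n : ℕ} {L : Type u} [Field L]

lemma comap_idealSheaf_ne_top {b : Ideal (MvPolynomial (Fin n) L)}
    (hb : b ≤ idealOfVars (Fin n) L) (V : (Spec (.of (MvPolynomial (Fin n) L))).Opens)
    (hV : origin n L ∈ V) : (idealSheaf b).comap V.ι ≠ ⊤ := by
  intro h
  let x : V.toScheme := ⟨origin n L, hV⟩
  have h1 := (stalkIdeal_comap_idealSheaf_pow_le_iff (I := b) V x (origin n L) rfl
    1 1).mpr fun u hu => ⟨1, ?_, ?_⟩
  · have h2 : x ∉ (⊤ : V.toScheme.IdealSheafData).support := id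
    rw [h, stalkIdeal_eq_top h2, Ideal.top_pow, top_le_iff] at h1
    have h3 := powIdeal_le_self (IsLocalRing.maximalIdeal (V.toScheme.presheaf.stalk x)) one_ne_zero
    rw [h1, top_le_iff] at h3
    exact Ideal.IsPrime.ne_top inferInstance h3
  · exact (Ideal.ne_top_iff_one _).mp (PrimeSpectrum.isPrime (origin n L)).ne_top
  · rw [one_mul]
    refine Ideal.subset_span ⟨u, ?_, pow_one u⟩
    rw [pow_one] at hu
    exact mem_asIdeal_origin.mpr (hb hu)

lemma isRegularLocalRing_stalk_opens (V : (Spec (.of (MvPolynomial (Fin n) L))).Opens)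
    (v : V.toScheme) : IsRegularLocalRing (V.toScheme.presheaf.stalk v) := by
  obtain ⟨_, h1, -⟩ := exists_isLocalization_stalk V v (V.ι v) rfl
  have := PrimeSpectrum.isPrime (V.ι v)
  exact .of_ringEquiv (IsLocalization.algEquiv (PrimeSpectrum.asIdeal (V.ι v)).primeCompl
    (Localization.AtPrime (PrimeSpectrum.asIdeal (V.ι v))) _).toRingEquiv

lemma isNoetherian_opens (V : (Spec (.of (MvPolynomial (Fin n) L))).Opens) :
    AlgebraicGeometry.IsNoetherian V.toScheme :=
  { toCompactSpace := isCompact_iff_compactSpace.mp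
      (TopologicalSpace.NoetherianSpace.isCompact (V : Set (Spec (.of (MvPolynomial (Fin n) L))))) }

lemma irreducibleSpace_opens (V : (Spec (.of (MvPolynomial (Fin n) L))).Opens)
    (hV : origin n L ∈ V) : IrreducibleSpace V.toScheme := by
  have : Nonempty V.toScheme := ⟨⟨origin n L, hV⟩⟩
  have := isIntegral_of_isOpenImmersion V.ι
  infer_instance

variable (n L) in
/-- The structure morphism of the affine space of dimension `n` over `L`. -/
abbrev affineSpaceMap : Spec (.of (MvPolynomial (Fin n) L)) ⟶ Spec (.of L) :=
  Spec.map (CommRingCat.ofHom C)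

instance : Smooth (affineSpaceMap n L) := by
  rw [HasRingHomProperty.Spec_iff (P := @Smooth)]
  exact (RingHom.smooth_algebraMap (R := L) (S := MvPolynomial (Fin n) L)).mpr {}

lemma le_idealOfVars_of_forall_eval_eq_zero
    {a : Ideal (MvPolynomial (Fin n) L)} (ha : ∀ f ∈ a, eval (0 : Fin n → L) f = 0) :
    a ≤ idealOfVars (Fin n) L := fun f hf => by
  rw [mem_idealOfVars_iff_constantCoeff, ← ha f hf, eval_zero]

theorem FptAffine_subset_FptFFinite [Fact p.Prime] : FptAffine.{u} p n ⊆ FptFFinite.{u} p n := by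
  rintro c ⟨L, _, _, _, a, ha, rfl⟩
  have ha' := le_idealOfVars_of_forall_eval_eq_zero ha
  obtain ⟨h1, V, hV, h2⟩ := exists_fpt_comap_eq_fptAt p ha'
  refine ⟨V.toScheme, ?_, ?_, isRegularLocalRing_stalk_opens V, ?_, ?_,
    topologicalKrullDim_of_origin_mem n L V hV, (idealSheaf a).comap V.ι,
    comap_idealSheaf_ne_top ha' V hV, h2.trans h1.symm⟩
  · exact isNoetherian_opens V
  · exact irreducibleSpace_opens V hV
  · have h3 := map_natCast (V.ι.appTop.hom.comp
      (Scheme.ΓSpecIso (.of (MvPolynomial (Fin n) L))).inv.hom) p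
    rw [← h3, CharP.cast_eq_zero, map_zero]
  · exact isFFinite_of_locallyOfFiniteType p (V.ι ≫ affineSpaceMap n L)

theorem FptAffine_subset_Fpt [Fact p.Prime] : FptAffine.{u} p n ⊆ Fpt.{u} p n := by
  rintro c ⟨L, _, _, _, a, ha, rfl⟩
  have ha' := le_idealOfVars_of_forall_eval_eq_zero ha
  obtain ⟨h1, V, hV, h2⟩ := exists_fpt_comap_eq_fptAt p ha'
  refine ⟨L, inferInstance, inferInstance, inferInstance, V.toScheme, V.ι ≫ affineSpaceMap n L,
    inferInstance, inferInstance, ?_, ?_, topologicalKrullDim_of_origin_mem n L V hV,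
    (idealSheaf a).comap V.ι, comap_idealSheaf_ne_top ha' V hV, h2.trans h1.symm⟩
  · have := isNoetherian_opens V
    infer_instance
  · exact irreducibleSpace_opens V hV

end Membership

/-! ### Regularity of smooth schemes over a field -/

section SmoothRegular

open IsLocalRing

/-- An étale algebra over a regular ring is regular: the maximal ideal of a local ring upstairs is
generated by the one downstairs, and the dimensions agree by going down. -/
lemma isRegularLocalRing_localization_of_etale {A B : Type*} [CommRing A] [IsRegularRing A]
    [CommRing B] [Algebra A B] [Algebra.Etale A B] (Q : Ideal B) [Q.IsPrime] :
    IsRegularLocalRing (Localization.AtPrime Q) := by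
  have : IsNoetherianRing B := Algebra.FiniteType.isNoetherianRing A B
  have : Module.Flat A B := Algebra.Smooth.flat A B
  let P := Q.under A
  let := Localization.AtPrime.algebraOfLiesOver P Q
  have h1 : P.map (algebraMap A (Localization.AtPrime Q)) = maximalIdeal (Localization.AtPrime Q) :=
    ((Algebra.isUnramifiedAt_iff_map_eq A P Q).mp inferInstance).2
  have h2 : (maximalIdeal (Localization.AtPrime P)).map
      (Localization.localRingHom P Q (algebraMap A B) rfl) =
        maximalIdeal (Localization.AtPrime Q) := by
    rw [← h1, ← Localization.AtPrime.map_eq_maximalIdeal, Ideal.map_map]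
    congr 1
    ext a
    simp [Localization.localRingHom_to_map,
      IsScalarTower.algebraMap_apply A B (Localization.AtPrime Q)]
  apply IsRegularLocalRing.of_spanFinrank_maximalIdeal_le
  have h3 : (maximalIdeal (Localization.AtPrime Q)).spanFinrank ≤
      (maximalIdeal (Localization.AtPrime P)).spanFinrank := by
    rw [← h2]
    exact Ideal.spanFinrank_map_le_of_fg _ (IsNoetherian.noetherian _)
  have h4 : P.height ≤ Q.height := by
    rw [Ideal.height_eq_height_add_of_liesOver_of_hasGoingDown P Q]
    exact le_self_add
  have h5 := (inferInstance : IsRegularLocalRing (Localization.AtPrime P)).spanFinrank_maximalIdeal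
  rw [IsLocalization.AtPrime.ringKrullDim_eq_height P (Localization.AtPrime P)] at h5
  rw [IsLocalization.AtPrime.ringKrullDim_eq_height Q (Localization.AtPrime Q)]
  calc _ ≤ (((maximalIdeal (Localization.AtPrime P)).spanFinrank : ℕ) : WithBot ℕ∞) := by
        exact_mod_cast h3
    _ = _ := h5
    _ ≤ _ := by exact_mod_cast h4

/-- Locally, a smooth scheme over a field is étale over an affine space. -/
lemma isRegularLocalRing_stalk_of_smooth {L : Type u} [Field L] {W : Scheme.{u}}
    (f : W ⟶ Spec (.of L)) [Smooth f] (x : W) : IsRegularLocalRing (W.presheaf.stalk x) := by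
  obtain ⟨U, hU, V, hV, hx, e, hstd⟩ := Smooth.exists_isStandardSmooth f x
  obtain rfl : U = ⊤ := by
    ext y
    have : Subsingleton (Spec (.of L)) := inferInstanceAs (Subsingleton (PrimeSpectrum L))
    rw [Subsingleton.elim y (f x)]
    simpa using e hx
  obtain ⟨k, g, -, hg⟩ := hstd.exists_etale_mvPolynomial
  let e' := (Scheme.ΓSpecIso (.of L)).symm.commRingCatIsoToRingEquiv
  have : IsRegularRing Γ(Spec (.of L), ⊤) := IsRegularRing.of_ringEquiv (R := L) e'
  algebraize [g]
  let := W.presheaf.algebra_section_stalk (⟨x, hx⟩ : V)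
  have := hV.isLocalization_stalk ⟨x, hx⟩
  have := isRegularLocalRing_localization_of_etale
    (A := MvPolynomial (Fin k) Γ(Spec (.of L), ⊤)) (hV.primeIdealOf ⟨x, hx⟩).asIdeal
  exact .of_ringEquiv (IsLocalization.algEquiv (hV.primeIdealOf ⟨x, hx⟩).asIdeal.primeCompl
    (Localization.AtPrime (hV.primeIdealOf ⟨x, hx⟩).asIdeal) (W.presheaf.stalk x)).toRingEquiv

end SmoothRegular

/-! ### Approximation by thresholds on affine space -/

section Density

open IsLocalRing MvPolynomial

variable {X : Scheme.{u}}

/-- On a Noetherian scheme the number of generators of the stalks of an ideal sheaf is bounded. -/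
lemma exists_card_le_span_eq_stalkIdeal [AlgebraicGeometry.IsNoetherian X] (a : X.IdealSheafData) :
    ∃ μ : ℕ, ∀ x, ∃ s : Finset (X.presheaf.stalk x), s.card ≤ μ ∧
      Ideal.span (s : Set (X.presheaf.stalk x)) = stalkIdeal a x := by
  classical
  choose U hU using exists_affineOpens_mem (X := X)
  have hfg : ∀ x, ∃ s : Finset Γ(X, U x), Ideal.span (s : Set Γ(X, U x)) = a.ideal (U x) := fun x =>
    have := IsLocallyNoetherian.component_noetherian (U x)
    IsNoetherian.noetherian (a.ideal (U x))
  choose s hs using hfg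
  obtain ⟨t, -, ht⟩ := isCompact_univ.elim_nhds_subcover (fun x => ((U x).1 : Set X))
    fun x _ => (U x).1.isOpen.mem_nhds (hU x)
  refine ⟨t.sup fun x => (s x).card, fun y => ?_⟩
  obtain ⟨x, hx, hy⟩ := Set.mem_iUnion₂.mp (ht (Set.mem_univ y))
  refine ⟨(s x).image (X.presheaf.germ (U x).1 y hy).hom, Finset.card_image_le.trans
    (Finset.le_sup (f := fun x => (s x).card) hx), ?_⟩
  rw [stalkIdeal_eq a (U x) hy, ← hs, Ideal.map_span, Finset.coe_image]

variable (p : ℕ) [Fact p.Prime]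

lemma charP_stalk (hp : (p : Γ(X, ⊤)) = 0) (x : X) : CharP (X.presheaf.stalk x) p := by
  have h1 : (p : X.presheaf.stalk x) = 0 := by
    rw [← map_natCast (X.presheaf.germ ⊤ x trivial).hom, hp, map_zero]
  exact ringChar.of_eq (CharP.ringChar_of_prime_eq_zero Fact.out h1)

lemma exists_testIdeal_ne_top [AlgebraicGeometry.IsNoetherian X] (hp : (p : Γ(X, ⊤)) = 0)
    {a : X.IdealSheafData} (ha : a ≠ ⊤) : ∃ t : ℝ, 0 ≤ t ∧ testIdeal p a t ≠ ⊤ := by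
  have hsupp : (a.support : Set X).Nonempty := by
    rw [Set.nonempty_iff_ne_empty]
    intro h0
    exact ha ((Scheme.IdealSheafData.support_eq_bot_iff _).mp (TopologicalSpace.Closeds.ext h0))
  obtain ⟨x, hx, hcl⟩ := a.support.isClosed.exists_closed_singleton hsupp
  have := charP_stalk p hp x
  obtain ⟨s, hs⟩ := IsNoetherian.noetherian (maximalIdeal (X.presheaf.stalk x))
  refine ⟨(1 + s.card : ℕ), Nat.cast_nonneg _, (testIdeal_ne_top_iff p a _).mpr fun N =>
    ⟨N, le_rfl, x, hcl, ?_⟩⟩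
  rw [← Nat.cast_pow, ← Nat.cast_mul, Nat.ceil_natCast]
  refine (Ideal.pow_right_mono (mem_support_iff_stalkIdeal_le.mp hx) _).trans ?_
  have h1 := pow_le_powIdeal_self p s N
  rwa [show Ideal.span (s : Set (X.presheaf.stalk x)) = maximalIdeal (X.presheaf.stalk x) from hs]
    at h1

/-- Containments at level `e` for exponents slightly above and slightly below `c = fpt p a`
determine a closed point `x`, and a polynomial model at `x` for this single `e` has a threshold
close to `c`. The error is `(μ + 1) / p ^ e`, where `μ` bounds the number of generators at all
points. -/
theorem fpt_mem_closure_FptAffine [AlgebraicGeometry.IsNoetherian X]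
    (hreg : ∀ x : X, IsRegularLocalRing (X.presheaf.stalk x)) (hp : (p : Γ(X, ⊤)) = 0) {n : ℕ}
    (hdim : topologicalKrullDim X ≤ n) {a : X.IdealSheafData} (ha : a ≠ ⊤) :
    fpt p a ∈ closure (FptAffine.{u} p n) := by
  have hp1 : (1 : ℝ) < p := by exact_mod_cast (Fact.out : p.Prime).one_lt
  obtain ⟨μ, hμ⟩ := exists_card_le_span_eq_stalkIdeal a
  set c := fpt p a with hc
  refine Metric.mem_closure_iff.mpr fun ε hε => ?_
  obtain ⟨t, ⟨ht0, ht⟩, htc⟩ : ∃ t ∈ {t : ℝ | 0 ≤ t ∧ testIdeal p a t ≠ ⊤}, t < c + ε / 2 :=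
    exists_lt_of_csInf_lt (exists_testIdeal_ne_top p hp ha) (by rw [← fpt, ← hc]; linarith)
  -- for negative `c - ε / 2` the lower bound will hold because thresholds are nonnegative
  obtain ⟨N, hN⟩ : ∃ N : ℕ, ∀ e ≥ N, ∀ x : X, IsClosed {x} → 0 ≤ c - ε / 2 →
      ¬ stalkIdeal a x ^ ⌈(c - ε / 2) * (p : ℝ) ^ e⌉₊ ≤
        powIdeal (maximalIdeal (X.presheaf.stalk x)) (p ^ e) := by
    by_cases h0 : 0 ≤ c - ε / 2
    · have h1 : ¬ testIdeal p a (c - ε / 2) ≠ ⊤ := fun h =>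
        absurd (csInf_le ⟨0, fun _ h => h.1⟩ (show c - ε / 2 ∈ {t : ℝ | 0 ≤ t ∧ testIdeal p a t ≠ ⊤}
          from ⟨h0, h⟩)) (by rw [← fpt, ← hc]; linarith)
      rw [testIdeal_ne_top_iff] at h1
      push Not at h1
      obtain ⟨N, hN⟩ := h1
      exact ⟨N, fun e he x hx _ => hN e he x hx⟩
    · exact ⟨0, fun e _ x _ h => absurd h h0⟩
  obtain ⟨E, hE⟩ : ∃ E : ℕ, ∀ e ≥ E, (μ + 1 : ℝ) / (p : ℝ) ^ e < ε / 2 := by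
    have h1 := (tendsto_pow_atTop_atTop_of_one_lt hp1).const_div_atTop (μ + 1 : ℝ)
    exact Filter.eventually_atTop.mp (h1.eventually_lt_const (by linarith))
  obtain ⟨e, he, x, hx, hle⟩ := (testIdeal_ne_top_iff p a t).mp ht (max N E)
  have hq : (0 : ℝ) < (p : ℝ) ^ e := by positivity
  have := hreg x
  have := charP_stalk p hp x
  obtain ⟨s, hscard, hs⟩ := hμ x
  have hsm : Ideal.span (s : Set (X.presheaf.stalk x)) ≤ maximalIdeal (X.presheaf.stalk x) := by
    rw [hs]
    exact Ideal.IsPrime.le_of_pow_le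
      (hle.trans (powIdeal_le_self _ (pow_pos (Fact.out : p.Prime).pos e).ne'))
  obtain ⟨L, _, _, _, w, hw, hwM, hiff⟩ := exists_polynomial_model p
    ((ringKrullDim_stalk_le_topologicalKrullDim x).trans hdim) s hsm e
  rw [hs] at hiff
  have : PerfectRing L p := PerfectField.toPerfectRing p
  refine ⟨threshold p (Ideal.span (w : Set (MvPolynomial (Fin n) L))) (idealOfVars (Fin n) L),
    ⟨L, inferInstance, inferInstance, inferInstance, Ideal.span w, fun f hf => ?_,
      (exists_fpt_comap_eq_fptAt p hwM).1⟩, ?_⟩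
  · rw [eval_zero]
    exact mem_idealOfVars_iff_constantCoeff.mp (hwM hf)
  have hupper := threshold_le_of_pow_le p w ((hiff _).mpr hle)
  have hlower : c - ε / 2 ≤
      threshold p (Ideal.span (w : Set (MvPolynomial (Fin n) L))) (idealOfVars (Fin n) L) := by
    rcases lt_or_ge (c - ε / 2) 0 with h0 | h0
    · exact h0.le.trans (threshold_nonneg p _ _)
    · have h1 := le_threshold_of_not_pow_le p
        (thresholdSet_nonempty p (idealOfVars_fg (Fin n) L) hwM)
        (mt (hiff _).mp (hN e ((le_max_left _ _).trans he) x hx h0))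
      refine le_trans ?_ h1
      rw [le_div_iff₀ hq]
      exact Nat.le_ceil _
  have h2 : ((⌈t * (p : ℝ) ^ e⌉₊ + w.card : ℕ) : ℝ) / (p : ℝ) ^ e ≤ t + (μ + 1) / (p : ℝ) ^ e := by
    rw [div_le_iff₀ hq, add_mul, div_mul_cancel₀ _ hq.ne']
    have h3 := Nat.ceil_lt_add_one (mul_nonneg ht0 hq.le)
    have h4 : (w.card : ℝ) ≤ μ := by exact_mod_cast hw.trans hscard
    push_cast
    linarith
  have h5 := hE e ((le_max_right _ _).trans he)
  rw [Real.dist_eq, abs_lt]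
  constructor <;> linarith

theorem FptFFinite_subset_closure (n : ℕ) :
    FptFFinite.{u} p n ⊆ closure (FptAffine.{u} p n) := by
  rintro c ⟨X, _, -, hreg, hp, -, hdim, a, ha, rfl⟩
  exact fpt_mem_closure_FptAffine p hreg hp hdim.le ha

theorem Fpt_subset_closure (n : ℕ) : Fpt.{u} p n ⊆ closure (FptAffine.{u} p n) := by
  rintro c ⟨L, _, _, _, W, f, _, _, _, -, hdim, a, ha, rfl⟩
  have := LocallyOfFiniteType.isLocallyNoetherian f
  have : CompactSpace W := QuasiCompact.compactSpace_of_compactSpace f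
  have : AlgebraicGeometry.IsNoetherian W := {}
  refine fpt_mem_closure_FptAffine p (isRegularLocalRing_stalk_of_smooth f) ?_ hdim.le ha
  rw [← map_natCast (f.appTop.hom.comp (Scheme.ΓSpecIso (.of L)).inv.hom) p, CharP.cast_eq_zero,
    map_zero]

end Density

end FThreshold

end

theorem proposition2p5 (p : ℕ) (hp : p.Prime) (n : ℕ) :
    (FThreshold.FptAffine.{u} p n ⊆ FThreshold.FptFFinite.{u} p n ∧
      FThreshold.FptFFinite.{u} p n ⊆ closure (FThreshold.FptAffine.{u} p n)) ∧
    (FThreshold.FptAffine.{u} p n ⊆ FThreshold.Fpt.{u} p n ∧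
      FThreshold.Fpt.{u} p n ⊆ closure (FThreshold.FptAffine.{u} p n)) := by
  have := Fact.mk hp
  exact ⟨⟨FThreshold.FptAffine_subset_FptFFinite p, FThreshold.FptFFinite_subset_closure p n⟩,
    FThreshold.FptAffine_subset_Fpt p, FThreshold.Fpt_subset_closure p n⟩
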